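/- **Setting.** Let $\alpha\in(0,1]$ and let $T_j:\mathcal X_j\to\mathcal X_{j+1}$, $j\ge 0$, be maps between metric spaces of diameter at most $1$, with numbers $\gamma_j\ge 1$, $\xi_j\in(0,1]$ such that all fibres $T_j^{-1}\{x\}$ are finite and, whenever $\rho_{j+1}(x,x')\le\xi_{j+1}$, there is a bijection $y_k\mapsto y_k'$ of $T_j^{-1}\{x\}$ onto $T_j^{-1}\{x'\}$ with $\rho_j(y_k,y_k')\le\min(\gamma_j^{-1}\rho_{j+1}(x,x'),\xi_j)$. Let $\|g\|_\alpha=\|g\|_\infty+v_\alpha(g)$ be the Hölder norm, $v_\alpha$ being the Hölder constant with exponent $\alpha$; let $\mathcal B_j$ be the space of functions $g:\mathcal X_j\to\mathbb C$ with $\|g\|_\alpha<\infty$, with dual $\mathcal B_j^*$; operator norms refer to $\|\cdot\|_\alpha$. Let $\phi_j,f_j:\mathcal X_j\to\mathbb R$ have finite norm $\|\cdot\|_\alpha$, and for $z\in\mathbb C$ put $$L_{j,z}g(x)=\sum_{T_jy=x}e^{\phi_j(y)+zf_j(y)}g(y),\qquad L^n_{j,z}=L_{j+n-1,z}\circ\dots\circ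 L_{j,z},\qquad L_j^n=L_{j,0}^n .$$ Let $\mu_j$ be Borel probability measures on $\mathcal X_j$, and assume $L_{j,0}\mathbf 1=\mathbf 1$, $(T_j)_*\mu_j=\mu_{j+1}$ and $\mu_j(f_j)=0$. Let $\beta,\bar\varepsilon,\eta_0,\delta,a,\kappa,a_0,a_1$ be real numbers with $\bar\varepsilon>0$, $\eta_0,\delta,a,a_1\ge0$, $0<\kappa<1$, $a_0>1$, and $\varepsilon:=\bar\varepsilon(1+\eta_0)<\beta$. Let $E_0,E_2,E_4,E_6,E_8,D>0$ and $E_3\ge1$ be constants and $R:\mathbb N\to\mathbb R$ a function, and let $0=m_0<m_1<m_2<\cdots$ be integers such that $\{m\ge1:R(m)\le D\}=\{m_1<m_2<\cdots\}$. Assume that * $\|L_j^n-\mu_j\|_\alpha\le E_0R(j+n)(1+j^{\bar\varepsilon})n^{-\beta}$ for $j\ge0$, $n\ge1$, where $\mu_j$ stands for $g\mapsto\mu_j(g)\mathbf 1$; * $m_n\le E_2n^{1+\eta_0}$ and $m_{n+1}-m_n\le E_3n^{\delta}$ for $n\ge1$; * $\|f_k\|_\alpha\le E_4\max(k,1)^a$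 and $\|\phi_k\|_\alpha\le E_4\max(k,1)^a$ for $k\ge0$; * $\prod_{k=s}^{s+d-1}\gamma_k^{-\alpha}\le E_6\max(s,1)^\kappa d^{-a_0}$ for $s\ge0$, $d\ge1$; * $\xi_j^{-1}\le E_8j^{a_1}$ for $j\ge1$. **Blocks and constants.** For $0<\varepsilon_0<1$ put $C_1=\max(1,E_0D(1+E_2^{\bar\varepsilon}))$, $u_0=2\varepsilon_0^{-1}+1$, $N_0=0$, $N_1=\lceil(u_0C_1)^{1/\beta}\rceil$, $N_{j+1}=N_j+\lceil(u_0C_1)^{1/\beta}N_j^{\varepsilon/\beta}\rceil$ for $j\ge1$, and $\ell_j=m_{N_j}$. For $J\in\mathbb N$ and $z\in\mathbb C$ let $$\mathcal A_{J,j,z}=L_{\ell_j,z}^{\ell_{j+1}-\ell_j}\ (0\le j\le J),\qquad \mathcal A_{J,j,z}=L_{\ell_j,0}^{\ell_{j+1}-\ell_j}\ (j>J),$$ $\mathcal A^n_{J,j,z}=\mathcal A_{J,j+n-1,z}\circ\dots\circ\mathcal A_{J,j,z}$. Put $$\zeta_1=\frac{\beta(a(1+\eta_0)+\delta)+\varepsilon}{\beta-\varepsilon},\qquad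 \zeta_2=\frac{(a+\kappa+a_1)\beta(1+\eta_0)}{\beta-\varepsilon},$$ $C_4=(u_0C_1)^{1/\beta}+1$, $A_2=C_4^{\beta/(\beta-\varepsilon)}$, $A_2'=C_4A_2^{\varepsilon/\beta}$, $Q_3=2^{\frac{\varepsilon+\delta\beta}{\beta-\varepsilon}}\max(E_2,E_3)A_2'A_2^{\delta}$, $E_5=Q_3E_4E_2^aA_2^{a(1+\eta_0)}$, $E_7=E_4E_6E_2^{\kappa+a}A_2^{(\kappa+a)(1+\eta_0)}$, $C'=\sum_{d\ge1}d^{-a_0}$ and $E_9=6E_8E_2^{a_1}A_2^{a_1(1+\eta_0)}(E_5+C'E_5E_7+C'E_7)$. **Proposition.** Let $0<\varepsilon_0<0.17$. There are constants $c,R_0,M>0$ depending only on $\varepsilon_0$ such that in every setting as above, and for every $J\in\mathbb N$, on the disc $$V_J=\{z\in\mathbb C:\ |z|\le c\,\min(E_5^{-1},E_9^{-1})(J+1)^{-\zeta_1-\zeta_2}\}$$ the following holds. There are triplets $\lambda_{J,j}(z)\in\mathbb C\setminus\{0\}$, $h_{J,j}^{(z)}\in\mathcal B_{\ell_j}$,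 $\nu_{J,j}^{(z)}\in\mathcal B_{\ell_j}^*$, $j\ge0$, analytic in $z$ on (a neighbourhood of) $V_J$, with norms at most $M$ for all $j$ and all $z\in V_J$, such that: (i) $\lambda_{J,j}(0)=1$, $h_{J,j}^{(0)}\equiv1$, $\nu_{J,j}^{(0)}=\mu_{\ell_j}$, and $\nu_{J,j}^{(z)}(\mathbf 1)=\nu_{J,j}^{(z)}(h_{J,j}^{(z)})=1$ for all $j$ and $z\in V_J$; (ii) $\mathcal A_{J,j,z}h_{J,j}^{(z)}=\lambda_{J,j}(z)h_{J,j+1}^{(z)}$ and $(\mathcal A_{J,j,z})^*\nu_{J,j+1}^{(z)}=\lambda_{J,j}(z)\nu_{J,j}^{(z)}$ for all $j$ and $z\in V_J$; (iii) for all $j,n\ge0$ and $z\in V_J$, with $\lambda_{J,j,n}(z)=\prod_{k=j}^{j+n-1}\lambda_{J,k}(z)$, $$\Big\|\lambda_{J,j,n}(z)^{-1}\mathcal A^n_{J,j,z}-\nu_{J,j}^{(z)}\otimes h_{J,j+n}^{(z)}\Big\|\le R_0(2\varepsilon_0)^n,$$ where $\nu\otimes h$ denotes the operator $g\mapsto\nu(g)h$.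 -/

import Mathlib

open MeasureTheory

noncomputable section

/-! ### Bounded Hölder functions -/

section Holder

variable {X : Type*} {E : Type*} [NormedAddCommGroup E]

/-- The supremum norm. -/
def supNorm (g : X → E) : ℝ := ⨆ x, ‖g x‖

lemma supNorm_nonneg (g : X → E) : 0 ≤ supNorm g := Real.iSup_nonneg fun _ => norm_nonneg _

variable [MetricSpace X]

/-- `g` is bounded and Hölder continuous with exponent `α`. -/
def IsHolder (α : ℝ) (g : X → E) : Prop :=
  ∃ C : ℝ, (∀ x, ‖g x‖ ≤ C) ∧ ∀ x y, ‖g x - g y‖ ≤ C * dist x y ^ α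

/-- The Hölder constant `v_α(g)`, the supremum of `‖g x - g y‖ / dist x y ^ α`. -/
def holderConst (α : ℝ) (g : X → E) : ℝ :=
  ⨆ p : X × X, ‖g p.1 - g p.2‖ / dist p.1 p.2 ^ α

/-- The Hölder norm `‖g‖_α = ‖g‖_∞ + v_α(g)`. -/
def holderNorm (α : ℝ) (g : X → E) : ℝ := supNorm g + holderConst α g

lemma IsHolder.exists_nonneg {α : ℝ} {g : X → E} (h : IsHolder α g) :
    ∃ C : ℝ, 0 ≤ C ∧ (∀ x, ‖g x‖ ≤ C) ∧ ∀ x y, ‖g x - g y‖ ≤ C * dist x y ^ α := by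
  obtain ⟨C, h1, h2⟩ := h
  refine ⟨|C|, abs_nonneg C, fun x => (h1 x).trans (le_abs_self C), fun x y => (h2 x y).trans ?_⟩
  exact mul_le_mul_of_nonneg_right (le_abs_self C) (Real.rpow_nonneg dist_nonneg α)

lemma IsHolder.bddAbove_sup {α : ℝ} {g : X → E} (h : IsHolder α g) :
    BddAbove (Set.range fun x => ‖g x‖) := by
  obtain ⟨C, h1, _⟩ := h
  exact ⟨C, by rintro _ ⟨x, rfl⟩; exact h1 x⟩

lemma IsHolder.bddAbove_const {α : ℝ} {g : X → E} (h : IsHolder α g) :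
    BddAbove (Set.range fun p : X × X => ‖g p.1 - g p.2‖ / dist p.1 p.2 ^ α) := by
  obtain ⟨C, h0, _, h2⟩ := h.exists_nonneg
  refine ⟨C, ?_⟩
  rintro _ ⟨p, rfl⟩
  exact div_le_of_le_mul₀ (Real.rpow_nonneg dist_nonneg α) h0 (h2 p.1 p.2)

lemma holderConst_nonneg (α : ℝ) (g : X → E) : 0 ≤ holderConst α g :=
  Real.iSup_nonneg fun _ => div_nonneg (norm_nonneg _) (Real.rpow_nonneg dist_nonneg α)

lemma holderNorm_nonneg (α : ℝ) (g : X → E) : 0 ≤ holderNorm α g :=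
  add_nonneg (supNorm_nonneg g) (holderConst_nonneg α g)

lemma IsHolder.norm_le_supNorm {α : ℝ} {g : X → E} (h : IsHolder α g) (x : X) :
    ‖g x‖ ≤ supNorm g :=
  le_ciSup h.bddAbove_sup x

lemma IsHolder.norm_sub_le_const {α : ℝ} {g : X → E} (h : IsHolder α g) (x y : X) :
    ‖g x - g y‖ ≤ holderConst α g * dist x y ^ α := by
  rcases eq_or_ne x y with rfl | hxy
  · simpa using mul_nonneg (holderConst_nonneg α g) (Real.rpow_nonneg (le_refl (0 : ℝ)) α)
  · have hd : 0 < dist x y ^ α := Real.rpow_pos_of_pos (dist_pos.2 hxy) α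
    exact (div_le_iff₀ hd).1 (le_ciSup h.bddAbove_const (x, y))

lemma IsHolder.norm_le {α : ℝ} {g : X → E} (h : IsHolder α g) (x : X) :
    ‖g x‖ ≤ holderNorm α g :=
  (h.norm_le_supNorm x).trans (le_add_of_nonneg_right (holderConst_nonneg α g))

lemma IsHolder.norm_sub_le {α : ℝ} {g : X → E} (h : IsHolder α g) (x y : X) :
    ‖g x - g y‖ ≤ holderNorm α g * dist x y ^ α :=
  (h.norm_sub_le_const x y).trans (mul_le_mul_of_nonneg_right
    (le_add_of_nonneg_left (supNorm_nonneg g)) (Real.rpow_nonneg dist_nonneg α))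

lemma holderNorm_le_add {α : ℝ} {g : X → E} {A B : ℝ} (hA : 0 ≤ A) (hB : 0 ≤ B)
    (h1 : ∀ x, ‖g x‖ ≤ A) (h2 : ∀ x y, ‖g x - g y‖ ≤ B * dist x y ^ α) :
    holderNorm α g ≤ A + B := by
  refine add_le_add (Real.iSup_le h1 hA) (Real.iSup_le (fun p => ?_) hB)
  exact div_le_of_le_mul₀ (Real.rpow_nonneg dist_nonneg α) hB (h2 p.1 p.2)

lemma isHolder_const (α : ℝ) (c : E) : IsHolder α (fun _ : X => c) :=
  ⟨‖c‖, fun _ => le_rfl, fun x y => by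
    simpa using mul_nonneg (norm_nonneg c) (Real.rpow_nonneg dist_nonneg α)⟩

lemma IsHolder.add {α : ℝ} {g k : X → E} (hg : IsHolder α g) (hk : IsHolder α k) :
    IsHolder α (g + k) := by
  obtain ⟨A, a1, a2⟩ := hg
  obtain ⟨B, b1, b2⟩ := hk
  refine ⟨A + B, fun x => (norm_add_le _ _).trans (add_le_add (a1 x) (b1 x)), fun x y => ?_⟩
  have : (g + k) x - (g + k) y = (g x - g y) + (k x - k y) := by simp only [Pi.add_apply]; abel
  rw [this, add_mul]
  exact (norm_add_le _ _).trans (add_le_add (a2 x y) (b2 x y))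

lemma IsHolder.smul {α : ℝ} {g : X → ℂ} (c : ℂ) (hg : IsHolder α g) : IsHolder α (c • g) := by
  obtain ⟨A, a1, a2⟩ := hg
  refine ⟨‖c‖ * A, fun x => ?_, fun x y => ?_⟩
  · simpa using mul_le_mul_of_nonneg_left (a1 x) (norm_nonneg c)
  · have : (c • g) x - (c • g) y = c * (g x - g y) := by simp [mul_sub]
    rw [this, norm_mul, mul_assoc]
    exact mul_le_mul_of_nonneg_left (a2 x y) (norm_nonneg c)

lemma IsHolder.ofReal {α : ℝ} {g : X → ℝ} (hg : IsHolder α g) :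
    IsHolder α (fun x => (g x : ℂ)) := by
  obtain ⟨A, a1, a2⟩ := hg
  refine ⟨A, fun x => by simpa using a1 x, fun x y => ?_⟩
  rw [← Complex.ofReal_sub, Complex.norm_real]
  exact a2 x y

lemma IsHolder.continuous {α : ℝ} (hα : 0 < α) {g : X → E} (hg : IsHolder α g) :
    Continuous g := by
  obtain ⟨A, a1, a2⟩ := hg
  rw [continuous_iff_continuousAt]
  intro x
  rw [ContinuousAt, tendsto_iff_norm_sub_tendsto_zero]
  refine squeeze_zero (fun _ => norm_nonneg _) (fun y => a2 y x) ?_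
  have h1 : Filter.Tendsto (fun y : X => dist y x) (nhds x) (nhds 0) :=
    tendsto_iff_dist_tendsto_zero.1 Filter.tendsto_id
  have h2 := (h1.rpow_const (p := α) (Or.inr hα.le)).const_mul A
  simpa [Real.zero_rpow hα.ne'] using h2

lemma norm_exp_sub_exp_le {B : ℝ} {u v : ℂ} (hu : ‖u‖ ≤ B) (hv : ‖v‖ ≤ B) :
    ‖Complex.exp u - Complex.exp v‖ ≤ Real.exp B * ‖u - v‖ := by
  refine (convex_closedBall (0 : ℂ) B).norm_image_sub_le_of_norm_deriv_le
    (f := Complex.exp) (fun x _ => Complex.differentiableAt_exp) (fun x hx => ?_)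
    (by simpa using hv) (by simpa using hu)
  rw [Complex.deriv_exp, Complex.norm_exp]
  exact Real.exp_le_exp.2 ((Complex.re_le_norm x).trans (by simpa using hx))

lemma IsHolder.cexp {α : ℝ} {u : X → ℂ} (hu : IsHolder α u) :
    IsHolder α (fun x => Complex.exp (u x)) := by
  obtain ⟨B, h0, b1, b2⟩ := hu.exists_nonneg
  refine ⟨Real.exp B * (1 + B), fun x => ?_, fun x y => ?_⟩
  · rw [Complex.norm_exp]
    calc Real.exp (u x).re ≤ Real.exp B :=
          Real.exp_le_exp.2 ((Complex.re_le_norm _).trans (b1 x))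
      _ ≤ Real.exp B * (1 + B) := le_mul_of_one_le_right (Real.exp_pos B).le (by linarith)
  · refine (norm_exp_sub_exp_le (b1 x) (b1 y)).trans ?_
    rw [mul_assoc]
    refine mul_le_mul_of_nonneg_left ((b2 x y).trans ?_) (Real.exp_pos B).le
    exact mul_le_mul_of_nonneg_right (by linarith) (Real.rpow_nonneg dist_nonneg α)

/-- The bounded `α`-Hölder functions as a subspace of all functions. -/
def holderSubmodule (α : ℝ) (X : Type*) [MetricSpace X] : Submodule ℂ (X → ℂ) where
  carrier := {g | IsHolder α g}
  add_mem' := fun h k => IsHolder.add h k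
  zero_mem' := isHolder_const α (0 : ℂ)
  smul_mem' := fun c _ h => IsHolder.smul c h

/-- The space of bounded complex `α`-Hölder functions on `X`, normed by `‖·‖_α`. -/
def HolderSpace (α : ℝ) (X : Type*) [MetricSpace X] : Type _ := ↥(holderSubmodule α X)

namespace HolderSpace

variable {α : ℝ}

instance : AddCommGroup (HolderSpace α X) :=
  inferInstanceAs (AddCommGroup ↥(holderSubmodule α X))

instance : Module ℂ (HolderSpace α X) := inferInstanceAs (Module ℂ ↥(holderSubmodule α X))

/-- The function underlying an element of the Hölder space. -/
def toFun (g : HolderSpace α X) : X → ℂ := Subtype.val g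

instance : CoeFun (HolderSpace α X) (fun _ => X → ℂ) := ⟨toFun⟩

lemma isHolder (g : HolderSpace α X) : IsHolder α g := Subtype.property g

/-- A Hölder function as an element of the Hölder space. -/
def mk (g : X → ℂ) (hg : IsHolder α g) : HolderSpace α X := ⟨g, hg⟩

@[simp] lemma mk_apply (g : X → ℂ) (hg : IsHolder α g) (x : X) : (mk g hg) x = g x := rfl

@[ext] lemma ext {g k : HolderSpace α X} (h : ∀ x, g x = k x) : g = k :=
  Subtype.ext (funext h)

@[simp] lemma add_apply (g k : HolderSpace α X) (x : X) : (g + k) x = g x + k x := rfl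

@[simp] lemma smul_apply (c : ℂ) (g : HolderSpace α X) (x : X) : (c • g) x = c * g x := rfl

@[simp] lemma zero_apply (x : X) : (0 : HolderSpace α X) x = 0 := rfl

instance : Norm (HolderSpace α X) := ⟨fun g => holderNorm α g⟩

lemma norm_def (g : HolderSpace α X) : ‖g‖ = holderNorm α g := rfl

lemma normCore : NormedSpace.Core ℂ (HolderSpace α X) where
  norm_nonneg g := holderNorm_nonneg α g
  norm_smul c g := by
    have key : ∀ (c : ℂ) (g : HolderSpace α X), ‖c • g‖ ≤ ‖c‖ * ‖g‖ := by
      intro c g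
      rw [norm_def, norm_def, holderNorm.eq_def α (g : X → ℂ), mul_add]
      refine holderNorm_le_add (mul_nonneg (norm_nonneg c) (supNorm_nonneg _))
        (mul_nonneg (norm_nonneg c) (holderConst_nonneg α _)) (fun x => ?_) (fun x y => ?_)
      · rw [smul_apply, norm_mul]
        exact mul_le_mul_of_nonneg_left (g.isHolder.norm_le_supNorm x) (norm_nonneg c)
      · rw [smul_apply, smul_apply, ← mul_sub, norm_mul, mul_assoc]
        exact mul_le_mul_of_nonneg_left (g.isHolder.norm_sub_le_const x y) (norm_nonneg c)
    refine le_antisymm (key c g) ?_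
    rcases eq_or_ne c 0 with rfl | hc
    · rw [norm_zero, zero_mul]
      exact holderNorm_nonneg α _
    · have h1 := key c⁻¹ (c • g)
      rw [smul_smul, inv_mul_cancel₀ hc, one_smul, norm_inv] at h1
      have hc' : 0 < ‖c‖ := norm_pos_iff.2 hc
      calc ‖c‖ * ‖g‖ ≤ ‖c‖ * (‖c‖⁻¹ * ‖c • g‖) := mul_le_mul_of_nonneg_left h1 hc'.le
        _ = ‖c • g‖ := by field_simp
  norm_triangle g k := by
    rw [norm_def, norm_def, norm_def]
    have : holderNorm α g + holderNorm α k
        = (supNorm g + supNorm k) + (holderConst α g + holderConst α k) := by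
      simp only [holderNorm]; ring
    rw [this]
    refine holderNorm_le_add (add_nonneg (supNorm_nonneg _) (supNorm_nonneg _))
      (add_nonneg (holderConst_nonneg α _) (holderConst_nonneg α _)) (fun x => ?_) (fun x y => ?_)
    · exact (norm_add_le _ _).trans
        (add_le_add (g.isHolder.norm_le_supNorm x) (k.isHolder.norm_le_supNorm x))
    · have e : (g + k) x - (g + k) y = (g x - g y) + (k x - k y) := by
        simp only [add_apply]; ring
      rw [e, add_mul]
      exact (norm_add_le _ _).trans
        (add_le_add (g.isHolder.norm_sub_le_const x y) (k.isHolder.norm_sub_le_const x y))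
  norm_eq_zero_iff g := by
    constructor
    · intro h
      ext x
      have := g.isHolder.norm_le x
      rw [norm_def] at h
      rw [h] at this
      simpa using this
    · rintro rfl
      refine le_antisymm ?_ (holderNorm_nonneg α _)
      have := holderNorm_le_add (g := ((0 : HolderSpace α X) : X → ℂ)) (α := α) le_rfl le_rfl
        (fun x => by simp) (fun x y => by simp)
      rwa [add_zero] at this

instance : NormedAddCommGroup (HolderSpace α X) := NormedAddCommGroup.ofCore normCore

instance : NormedSpace ℂ (HolderSpace α X) := NormedSpace.ofCore normCore

/-- The constant function `1`. -/
def one : HolderSpace α X := mk (fun _ => 1) (isHolder_const α 1)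

end HolderSpace

end Holder

/-! ### Compositions along a sequence of spaces -/

/-- `seqIter A j n = A (j+n-1) ∘ ⋯ ∘ A (j+1) ∘ A j`. -/
def seqIter {B : ℕ → Type*} [∀ j, NormedAddCommGroup (B j)] [∀ j, NormedSpace ℂ (B j)]
    (A : ∀ j, B j →L[ℂ] B (j + 1)) (j : ℕ) : ∀ n, B j →L[ℂ] B (j + n)
  | 0 => ContinuousLinearMap.id ℂ (B j)
  | n + 1 => (A (j + n)).comp (seqIter A j n)

/-! ### Sequences of expanding maps and their transfer operators -/

/-- A sequence of maps `T j : X j → X (j+1)` between metric spaces of diameter at most one, with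
finite fibres that are paired along nearby base points, together with potentials `φ j` whose
transfer operators are normalized, observables `f j`, and equivariant probability measures. -/
structure ExpandingSequence (X : ℕ → Type*) [∀ j, MetricSpace (X j)]
    [∀ j, MeasurableSpace (X j)] [∀ j, BorelSpace (X j)] (α : ℝ) where
  T : ∀ j, X j → X (j + 1)
  γ : ℕ → ℝ
  ξ : ℕ → ℝ
  φ : ∀ j, X j → ℝ
  f : ∀ j, X j → ℝ
  μ : ∀ j, Measure (X j)
  α_pos : 0 < α
  α_le_one : α ≤ 1
  dist_le_one : ∀ j (x x' : X j), dist x x' ≤ 1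
  one_le_γ : ∀ j, 1 ≤ γ j
  ξ_pos : ∀ j, 0 < ξ j
  ξ_le_one : ∀ j, ξ j ≤ 1
  finite_fibre : ∀ j (x : X (j + 1)), (T j ⁻¹' {x}).Finite
  pairing : ∀ j (x x' : X (j + 1)), dist x x' ≤ ξ (j + 1) →
    ∃ e : ↥(T j ⁻¹' {x}) ≃ ↥(T j ⁻¹' {x'}), ∀ y : ↥(T j ⁻¹' {x}),
      dist (y : X j) (e y : X j) ≤ min ((γ j)⁻¹ * dist x x') (ξ j)
  isHolder_φ : ∀ j, IsHolder α (φ j)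
  isHolder_f : ∀ j, IsHolder α (f j)
  normalized : ∀ j (x : X (j + 1)), ∑ᶠ y : ↥(T j ⁻¹' {x}), Real.exp (φ j y) = 1
  isProbabilityMeasure : ∀ j, IsProbabilityMeasure (μ j)
  measurePreserving : ∀ j, MeasurePreserving (T j) (μ j) (μ (j + 1))
  integral_f : ∀ j, ∫ x, f j x ∂μ j = 0

namespace ExpandingSequence

variable {X : ℕ → Type*} [∀ j, MetricSpace (X j)] [∀ j, MeasurableSpace (X j)]
  [∀ j, BorelSpace (X j)] {α : ℝ} (S : ExpandingSequence X α)

/-- The transfer operator on functions: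
`(L_{j,z} g)(x) = ∑_{T_j y = x} exp (φ_j y + z f_j y) g y`. -/
def transferFun (j : ℕ) (z : ℂ) (g : X j → ℂ) (x : X (j + 1)) : ℂ :=
  ∑ᶠ y : ↥(S.T j ⁻¹' {x}), Complex.exp ((S.φ j y : ℂ) + z * (S.f j y : ℂ)) * g y

instance (j : ℕ) (x : X (j + 1)) : Finite ↥(S.T j ⁻¹' {x}) := (S.finite_fibre j x).to_subtype

/-- The number of preimages is bounded. -/
lemma card_fibre_le (j : ℕ) (x : X (j + 1)) :
    (Nat.card ↥(S.T j ⁻¹' {x}) : ℝ) ≤ Real.exp (holderNorm α (S.φ j)) := by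
  have := Fintype.ofFinite ↥(S.T j ⁻¹' {x})
  have h1 := S.normalized j x
  rw [finsum_eq_sum_of_fintype] at h1
  have h2 : ∀ y : ↥(S.T j ⁻¹' {x}),
      Real.exp (-holderNorm α (S.φ j)) ≤ Real.exp (S.φ j y) := fun y =>
    Real.exp_le_exp.2 (by
      have := (S.isHolder_φ j).norm_le (y : X j)
      rw [Real.norm_eq_abs] at this
      exact (abs_le.1 this).1)
  have h3 := Finset.sum_le_sum (s := Finset.univ) (fun y _ => h2 y)
  rw [h1, Finset.sum_const, nsmul_eq_mul, Finset.card_univ, ← Nat.card_eq_fintype_card,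
    Real.exp_neg] at h3
  have hp := Real.exp_pos (holderNorm α (S.φ j))
  rwa [← div_eq_mul_inv, div_le_one hp] at h3

lemma exists_transferFun_bound (j : ℕ) (z : ℂ) :
    ∃ C : ℝ, 0 ≤ C ∧ ∀ g : HolderSpace α (X j),
      (∀ x, ‖S.transferFun j z g x‖ ≤ C * ‖g‖) ∧
      ∀ x x', ‖S.transferFun j z g x - S.transferFun j z g x'‖ ≤ C * ‖g‖ * dist x x' ^ α := by
  have hw : IsHolder α (fun y : X j => Complex.exp ((S.φ j y : ℂ) + z * (S.f j y : ℂ))) := by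
    have h := (S.isHolder_φ j).ofReal.add ((S.isHolder_f j).ofReal.smul z)
    exact IsHolder.cexp h
  obtain ⟨W, hW0, hW1, hW2⟩ := hw.exists_nonneg
  set w : X j → ℂ := fun y => Complex.exp ((S.φ j y : ℂ) + z * (S.f j y : ℂ)) with hwdef
  set d : ℝ := Real.exp (holderNorm α (S.φ j)) with hd
  have hd0 : 0 ≤ d := (Real.exp_pos _).le
  set r : ℝ := S.ξ (j + 1) ^ α with hr
  have hr0 : 0 < r := Real.rpow_pos_of_pos (S.ξ_pos _) α
  have hr1 : r ≤ 1 := Real.rpow_le_one (S.ξ_pos _).le (S.ξ_le_one _) S.α_pos.le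
  have hri : 1 ≤ r⁻¹ := (one_le_inv₀ hr0).2 hr1
  have hsup : ∀ (g : HolderSpace α (X j)) x, ‖S.transferFun j z g x‖ ≤ d * (W * ‖g‖) := by
    intro g x
    have := Fintype.ofFinite ↥(S.T j ⁻¹' {x})
    rw [transferFun, finsum_eq_sum_of_fintype]
    refine (norm_sum_le _ _).trans ?_
    refine (Finset.sum_le_sum (g := fun _ => W * ‖g‖) fun y _ => ?_).trans ?_
    · rw [norm_mul]
      exact mul_le_mul (hW1 y) (g.isHolder.norm_le y) (norm_nonneg _) hW0
    · rw [Finset.sum_const, nsmul_eq_mul, Finset.card_univ, ← Nat.card_eq_fintype_card]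
      exact mul_le_mul_of_nonneg_right (S.card_fibre_le j x) (mul_nonneg hW0 (norm_nonneg _))
  refine ⟨2 * d * W * r⁻¹, by positivity, fun g => ⟨fun x => ?_, fun x x' => ?_⟩⟩
  · refine (hsup g x).trans ?_
    have h0 : 0 ≤ d * (W * ‖g‖) := by positivity
    calc d * (W * ‖g‖) ≤ d * (W * ‖g‖) * (2 * r⁻¹) :=
          le_mul_of_one_le_right h0 (by linarith)
      _ = 2 * d * W * r⁻¹ * ‖g‖ := by ring
  · by_cases hx : dist x x' ≤ S.ξ (j + 1)
    · obtain ⟨e, he⟩ := S.pairing j x x' hx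
      have := Fintype.ofFinite ↥(S.T j ⁻¹' {x})
      have := Fintype.ofFinite ↥(S.T j ⁻¹' {x'})
      rw [transferFun, transferFun, finsum_eq_sum_of_fintype, finsum_eq_sum_of_fintype,
        ← Equiv.sum_comp e, ← Finset.sum_sub_distrib]
      refine (norm_sum_le _ _).trans ?_
      refine (Finset.sum_le_sum (g := fun _ => 2 * W * ‖g‖ * dist x x' ^ α) fun y _ => ?_).trans ?_
      · have hdist : dist (y : X j) (e y : X j) ^ α ≤ dist x x' ^ α := by
          refine Real.rpow_le_rpow dist_nonneg ?_ S.α_pos.le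
          refine (he y).trans ((min_le_left _ _).trans ?_)
          exact mul_le_of_le_one_left dist_nonneg (inv_le_one_of_one_le₀ (S.one_le_γ j))
        change ‖w y * g y - w (e y) * g (e y)‖ ≤ _
        have e1 : w y * g y - w (e y) * g (e y)
            = w y * (g y - g (e y)) + (w y - w (e y)) * g (e y) := by ring
        rw [e1]
        refine (norm_add_le _ _).trans ?_
        rw [norm_mul, norm_mul]
        have b1 : ‖w y‖ * ‖g y - g (e y)‖ ≤ W * (‖g‖ * dist x x' ^ α) := by
          refine mul_le_mul (hW1 y) ((g.isHolder.norm_sub_le y (e y)).trans ?_)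
            (norm_nonneg _) hW0
          exact mul_le_mul_of_nonneg_left hdist (norm_nonneg g)
        have b2 : ‖w y - w (e y)‖ * ‖g (e y)‖ ≤ (W * dist x x' ^ α) * ‖g‖ := by
          refine mul_le_mul ((hW2 y (e y)).trans ?_) (g.isHolder.norm_le _) (norm_nonneg _) ?_
          · exact mul_le_mul_of_nonneg_left hdist hW0
          · exact mul_nonneg hW0 (Real.rpow_nonneg dist_nonneg α)
        calc _ ≤ _ := add_le_add b1 b2
          _ = _ := by ring
      · rw [Finset.sum_const, nsmul_eq_mul, Finset.card_univ, ← Nat.card_eq_fintype_card]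
        have hq : 0 ≤ 2 * W * ‖g‖ * dist x x' ^ α := by
          have := Real.rpow_nonneg (dist_nonneg (x := x) (y := x')) α
          positivity
        calc _ ≤ d * (2 * W * ‖g‖ * dist x x' ^ α) :=
              mul_le_mul_of_nonneg_right (S.card_fibre_le j x) hq
          _ ≤ d * (2 * W * ‖g‖ * dist x x' ^ α) * r⁻¹ :=
              le_mul_of_one_le_right (mul_nonneg hd0 hq) hri
          _ = _ := by ring
    · have hfar : r ≤ dist x x' ^ α :=
        Real.rpow_le_rpow (S.ξ_pos _).le (not_le.1 hx).le S.α_pos.le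
      have h1 : 1 ≤ r⁻¹ * dist x x' ^ α := by
        rw [inv_mul_eq_div, one_le_div hr0]; exact hfar
      have h0 : 0 ≤ 2 * (d * (W * ‖g‖)) := by positivity
      calc _ ≤ _ := norm_sub_le _ _
        _ ≤ d * (W * ‖g‖) + d * (W * ‖g‖) := add_le_add (hsup g x) (hsup g x')
        _ = 2 * (d * (W * ‖g‖)) := by ring
        _ ≤ 2 * (d * (W * ‖g‖)) * (r⁻¹ * dist x x' ^ α) := le_mul_of_one_le_right h0 h1
        _ = _ := by ring

lemma isHolder_transferFun (j : ℕ) (z : ℂ) (g : HolderSpace α (X j)) :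
    IsHolder α (S.transferFun j z g) := by
  obtain ⟨C, _, hC⟩ := S.exists_transferFun_bound j z
  exact ⟨C * ‖g‖, (hC g).1, (hC g).2⟩

/-- The transfer operator `L_{j,z}` as a bounded operator between Hölder spaces. -/
def transfer (j : ℕ) (z : ℂ) : HolderSpace α (X j) →L[ℂ] HolderSpace α (X (j + 1)) :=
  LinearMap.mkContinuousOfExistsBound
    { toFun := fun g => HolderSpace.mk (S.transferFun j z g) (S.isHolder_transferFun j z g)
      map_add' := fun g k => by
        ext x
        have := Fintype.ofFinite ↥(S.T j ⁻¹' {x})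
        simp [transferFun, finsum_eq_sum_of_fintype, mul_add, Finset.sum_add_distrib]
      map_smul' := fun c g => by
        ext x
        have := Fintype.ofFinite ↥(S.T j ⁻¹' {x})
        simp [transferFun, finsum_eq_sum_of_fintype, Finset.mul_sum, mul_left_comm] }
    (by
      obtain ⟨C, hC0, hC⟩ := S.exists_transferFun_bound j z
      refine ⟨C + C, fun g => ?_⟩
      rw [add_mul]
      exact holderNorm_le_add (by positivity) (by positivity) (hC g).1 (hC g).2)

lemma transfer_apply (j : ℕ) (z : ℂ) (g : HolderSpace α (X j)) (x : X (j + 1)) :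
    S.transfer j z g x
      = ∑ᶠ y : ↥(S.T j ⁻¹' {x}), Complex.exp ((S.φ j y : ℂ) + z * (S.f j y : ℂ)) * g y := rfl

lemma integrable_holder (j : ℕ) (g : HolderSpace α (X j)) : Integrable (g : X j → ℂ) (S.μ j) := by
  have := S.isProbabilityMeasure j
  exact Integrable.of_bound (g.isHolder.continuous S.α_pos).aestronglyMeasurable ‖g‖
    (Filter.Eventually.of_forall fun x => g.isHolder.norm_le x)

/-- The measure `μ_j` as a functional `g ↦ ∫ g dμ_j` on the Hölder space. -/
def meas (j : ℕ) : HolderSpace α (X j) →L[ℂ] ℂ :=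
  LinearMap.mkContinuous
    { toFun := fun g => ∫ x, g x ∂S.μ j
      map_add' := fun g k => by
        simpa using integral_add (S.integrable_holder j g) (S.integrable_holder j k)
      map_smul' := fun c g => by simp [integral_const_mul] } 1
    (fun g => by
      have := S.isProbabilityMeasure j
      have := norm_integral_le_of_norm_le_const (μ := S.μ j)
        (Filter.Eventually.of_forall fun x => g.isHolder.norm_le x)
      rw [probReal_univ, mul_one] at this
      rwa [one_mul])

lemma meas_apply (j : ℕ) (g : HolderSpace α (X j)) : S.meas j g = ∫ x, g x ∂S.μ j := rfl

end ExpandingSequence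

/-! ### Constants, standing estimates and blocks -/

/-- The exponents and constants that enter the standing estimates. -/
structure Constants where
  β : ℝ
  εbar : ℝ
  η₀ : ℝ
  δ : ℝ
  a : ℝ
  κ : ℝ
  a₀ : ℝ
  a₁ : ℝ
  D : ℝ
  E₀ : ℝ
  E₂ : ℝ
  E₃ : ℝ
  E₄ : ℝ
  E₆ : ℝ
  E₈ : ℝ
  εbar_pos : 0 < εbar
  η₀_nonneg : 0 ≤ η₀
  lt_β : εbar * (1 + η₀) < β
  δ_nonneg : 0 ≤ δ
  a_nonneg : 0 ≤ a
  κ_pos : 0 < κ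
  κ_lt_one : κ < 1
  one_lt_a₀ : 1 < a₀
  a₁_nonneg : 0 ≤ a₁
  D_pos : 0 < D
  E₀_pos : 0 < E₀
  E₂_pos : 0 < E₂
  one_le_E₃ : 1 ≤ E₃
  E₄_pos : 0 < E₄
  E₆_pos : 0 < E₆
  E₈_pos : 0 < E₈

namespace Constants

variable (P : Constants) (ε₀ : ℝ)

/-- `ε = ε̄ (1 + η₀)`. -/
def ε : ℝ := P.εbar * (1 + P.η₀)

/-- The constant in `‖𝒟_j^n - μ_{m_j}‖ ≤ C₁ (1 + j^ε) n^{-β}`, `𝒟_j = L_{m_j}^{m_{j+1}-m_j}`. -/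
def C₁ : ℝ := max 1 (P.E₀ * P.D * (1 + P.E₂ ^ P.εbar))

/-- `(u₀ C₁)^{1/β}` with `u₀ = 2 / ε₀ + 1`. -/
def blockScale : ℝ := ((2 / ε₀ + 1) * P.C₁) ^ (1 / P.β)

/-- The endpoints `N_j` of the blocks of indices: `N_0 = 0`, `N_1 = ⌈(u₀ C₁)^{1/β}⌉` and
`N_{j+1} = N_j + ⌈(u₀ C₁)^{1/β} N_j^{ε/β}⌉` for `j ≥ 1`. -/
def N : ℕ → ℕ
  | 0 => 0
  | 1 => ⌈P.blockScale ε₀⌉₊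
  | j + 2 => N (j + 1) + ⌈P.blockScale ε₀ * (N (j + 1) : ℝ) ^ (P.ε / P.β)⌉₊

def C₄ : ℝ := P.blockScale ε₀ + 1

def A₂ : ℝ := P.C₄ ε₀ ^ (P.β / (P.β - P.ε))

def A₂' : ℝ := P.C₄ ε₀ * P.A₂ ε₀ ^ (P.ε / P.β)

def Q₃ : ℝ := 2 ^ ((P.ε + P.δ * P.β) / (P.β - P.ε)) * max P.E₂ P.E₃ * P.A₂' ε₀ * P.A₂ ε₀ ^ P.δ

def E₅ : ℝ := P.Q₃ ε₀ * P.E₄ * P.E₂ ^ P.a * P.A₂ ε₀ ^ (P.a * (1 + P.η₀))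

def E₇ : ℝ := P.E₄ * P.E₆ * P.E₂ ^ (P.κ + P.a) * P.A₂ ε₀ ^ ((P.κ + P.a) * (1 + P.η₀))

/-- `C' = ∑_{d ≥ 1} d^{-a₀}`. -/
def C' : ℝ := ∑' d : ℕ, ((d : ℝ) + 1) ^ (-P.a₀)

def E₉ : ℝ :=
  6 * P.E₈ * P.E₂ ^ P.a₁ * P.A₂ ε₀ ^ (P.a₁ * (1 + P.η₀))
    * (P.E₅ ε₀ + P.C' * P.E₅ ε₀ * P.E₇ ε₀ + P.C' * P.E₇ ε₀)

def ζ₁ : ℝ := (P.β * (P.a * (1 + P.η₀) + P.δ) + P.ε) / (P.β - P.ε)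

def ζ₂ : ℝ := (P.a + P.κ + P.a₁) * P.β * (1 + P.η₀) / (P.β - P.ε)

/-- The closed disc `V_J` of radius `c min(E₅⁻¹, E₉⁻¹) (J+1)^{-ζ₁-ζ₂}`. -/
def disc (c : ℝ) (J : ℕ) : Set ℂ :=
  Metric.closedBall 0
    (c * min (P.E₅ ε₀)⁻¹ (P.E₉ ε₀)⁻¹ * ((J : ℝ) + 1) ^ (-P.ζ₁ - P.ζ₂))

/-- The block endpoints `ℓ_j = m_{N_j}`, in recursive form (see `ell_eq`). -/
def ell (m : ℕ → ℕ) : ℕ → ℕ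
  | 0 => m (P.N ε₀ 0)
  | j + 1 => ell m j + (m (P.N ε₀ (j + 1)) - m (P.N ε₀ j))

lemma N_le_succ (j : ℕ) : P.N ε₀ j ≤ P.N ε₀ (j + 1) := by
  cases j with
  | zero => simp [N]
  | succ j => simp [N]

lemma ell_eq {m : ℕ → ℕ} (hm : Monotone m) (j : ℕ) : P.ell ε₀ m j = m (P.N ε₀ j) := by
  induction j with
  | zero => rfl
  | succ j ih =>
    have := hm (P.N_le_succ ε₀ j)
    simp only [ell, ih]
    omega

end Constants

namespace ExpandingSequence

variable {X : ℕ → Type*} [∀ j, MetricSpace (X j)] [∀ j, MeasurableSpace (X j)]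
  [∀ j, BorelSpace (X j)] {α : ℝ} (S : ExpandingSequence X α)

/-- The standing quantitative assumptions: polynomial convergence of the unperturbed iterates with
a weight `R`, the times `0 = m_0 < m_1 < m_2 < ⋯` where `m_1, m_2, …` enumerate the positive
integers with `R ≤ D`, polynomial growth of `φ_j`, `f_j` and `ξ_j⁻¹`, and polynomial decay of the
products of the contraction rates. Powers of an index `0` are read as powers of `1` where the
literal reading would force the corresponding quantity to vanish. -/
structure Standing (P : Constants) (R : ℕ → ℝ) (m : ℕ → ℕ) : Prop where
  convergence : ∀ j n : ℕ, 1 ≤ n →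
    ‖seqIter (fun i => S.transfer i 0) j n - (S.meas j).smulRight HolderSpace.one‖
      ≤ P.E₀ * R (j + n) * (1 + (j : ℝ) ^ P.εbar) * (n : ℝ) ^ (-P.β)
  m_zero : m 0 = 0
  m_strictMono : StrictMono m
  good_times : {k : ℕ | 1 ≤ k ∧ R k ≤ P.D} = m '' Set.Ici 1
  m_le : ∀ n : ℕ, 1 ≤ n → (m n : ℝ) ≤ P.E₂ * (n : ℝ) ^ (1 + P.η₀)
  gap_le : ∀ n : ℕ, 1 ≤ n → (m (n + 1) : ℝ) - m n ≤ P.E₃ * (n : ℝ) ^ P.δ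
  f_le : ∀ k : ℕ, holderNorm α (S.f k) ≤ P.E₄ * (max (k : ℝ) 1) ^ P.a
  φ_le : ∀ k : ℕ, holderNorm α (S.φ k) ≤ P.E₄ * (max (k : ℝ) 1) ^ P.a
  γ_decay : ∀ s d : ℕ, 1 ≤ d →
    ∏ k ∈ Finset.range d, S.γ (s + k) ^ (-α)
      ≤ P.E₆ * (max (s : ℝ) 1) ^ P.κ * (d : ℝ) ^ (-P.a₀)
  ξ_inv_le : ∀ j : ℕ, 1 ≤ j → (S.ξ j)⁻¹ ≤ P.E₈ * (j : ℝ) ^ P.a₁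

/-- The block operator `L_{ℓ_j,z}^{ℓ_{j+1}-ℓ_j}`. -/
def block (P : Constants) (ε₀ : ℝ) (m : ℕ → ℕ) (j : ℕ) (z : ℂ) :
    HolderSpace α (X (P.ell ε₀ m j)) →L[ℂ] HolderSpace α (X (P.ell ε₀ m (j + 1))) :=
  seqIter (fun i => S.transfer i z) (P.ell ε₀ m j) (m (P.N ε₀ (j + 1)) - m (P.N ε₀ j))

/-- `𝒜_{J,j,z}`: the block operator at `z` for `j ≤ J`, and the one at `0` for `j > J`. -/
def blockJ (P : Constants) (ε₀ : ℝ) (m : ℕ → ℕ) (J : ℕ) (z : ℂ) (j : ℕ) :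
    HolderSpace α (X (P.ell ε₀ m j)) →L[ℂ] HolderSpace α (X (P.ell ε₀ m (j + 1))) :=
  S.block P ε₀ m j (if j ≤ J then z else 0)

end ExpandingSequence

end

/-! The proof is a perturbation argument around rank one projections, with no limits taken. Along
good times `R ≤ D`, so the assumed convergence, over blocks whose lengths outgrow the factor `1 + j
^ εbar`, makes each unperturbed block operator lie within `ε₀ / 2` of `g ↦ μ(g) 1`
(`norm_block_zero_sub_le`). If `z` is in the disc, each perturbed block with `j ≤ J` lies within `ε₀
/ 20` of the unperturbed one (`norm_block_sub_le`).

Given these two bounds, everything is abstract (`exists_triplets`). Beyond `J` the operators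
preserve the functionals `μ j`, so the eigenfunctional at `j ≤ J` is a finite pull-back of `μ (J +
1)`, normalized at `e j`. Backward induction keeps it within `θ / 2` of `μ j`. The eigenvalue is the
normalizing factor, and the eigenvector is the normalized push-forward of `e 0`. On the kernel of
the eigenfunctional the normalized operator contracts by `2 * θ`. This bounds the eigenvectors and,
after splitting a vector into its eigenvector and kernel parts, gives the exponential convergence.
Only finite compositions and divisions by nonzero numbers occur, so the triplets are analytic as
soon as the operators are. They are, since `L_z = L_0 ∘ exp (z M_f)` with `M_f` multiplication by
`f`.

The closeness of perturbed blocks rests on pairing the preimages of nearby points through a whole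
block (`exists_paired_preimages`). The iterates are then sums with weights `exp a` of total mass
one, and their difference is governed by the size of the Birkhoff sums of `f` and the Hölder
constants along paired branches of those of `φ` and `f`. For distant points the sup bound suffices,
at the cost of a factor `ξ⁻¹`. All these quantities grow polynomially in the block index because
`N_j` grows at most like `j ^ (β / (β - ε))`; the exponents add up to at most `ζ₁ + ζ₂`, which the
radius of the disc compensates. -/

noncomputable section

/-! ### Abstract perturbation of sequences of rank one projections -/

section Perturbation

variable {B : ℕ → Type*} [∀ j, NormedAddCommGroup (B j)] [∀ j, NormedSpace ℂ (B j)]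

/-- The functional `μ (j + n) ∘ A (j + n - 1) ∘ ⋯ ∘ A j`. -/
def pullBack (A : ∀ j, B j →L[ℂ] B (j + 1)) (μ : ∀ j, B j →L[ℂ] ℂ) :
    ℕ → ∀ j, B j →L[ℂ] ℂ
  | 0, j => μ j
  | n + 1, j => (pullBack A μ n (j + 1)).comp (A j)

/-- Operators `A j`, equal to `A₀ j` for `j > J`, that are close to operators `A₀ j` which in turn
are close to the projections `μ j ⊗ e (j + 1)`. -/
structure NearRankOne (θ : ℝ) (e : ∀ j, B j) (μ : ∀ j, B j →L[ℂ] ℂ)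
    (A₀ A : ∀ j, B j →L[ℂ] B (j + 1)) (J : ℕ) : Prop where
  pos : 0 < θ
  lt : θ < 0.17
  norm_e : ∀ j, ‖e j‖ ≤ 1
  norm_μ : ∀ j, ‖μ j‖ ≤ 1
  μ_e : ∀ j, μ j (e j) = 1
  map_e : ∀ j, A₀ j (e j) = e (j + 1)
  comp_μ : ∀ j, (μ (j + 1)).comp (A₀ j) = μ j
  close_rankOne : ∀ j, ‖A₀ j - (μ j).smulRight (e (j + 1))‖ ≤ θ / 2
  close : ∀ j, ‖A j - A₀ j‖ ≤ θ / 20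
  eq_of_lt : ∀ j, J < j → A j = A₀ j

/-- The eigenfunctional before normalization: the pull-back of `μ (J + 1)` for `j ≤ J`, and `μ j`
for `j > J`. -/
def rawFunctional (A : ∀ j, B j →L[ℂ] B (j + 1)) (μ : ∀ j, B j →L[ℂ] ℂ) (J j : ℕ) :
    B j →L[ℂ] ℂ := pullBack A μ (J + 1 - j) j

/-- The eigenfunctional, normalized to take the value `1` at `e j`. -/
def eigenFunctional (e : ∀ j, B j) (μ : ∀ j, B j →L[ℂ] ℂ) (A : ∀ j, B j →L[ℂ] B (j + 1))
    (J j : ℕ) : B j →L[ℂ] ℂ :=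
  (rawFunctional A μ J j (e j))⁻¹ • rawFunctional A μ J j

/-- The eigenvalue. -/
def eigenValue (e : ∀ j, B j) (μ : ∀ j, B j →L[ℂ] ℂ) (A : ∀ j, B j →L[ℂ] B (j + 1))
    (J j : ℕ) : ℂ := eigenFunctional e μ A J (j + 1) (A j (e j))

/-- The eigenvector. -/
def eigenVector (e : ∀ j, B j) (μ : ∀ j, B j →L[ℂ] ℂ) (A : ∀ j, B j →L[ℂ] B (j + 1))
    (J : ℕ) : ∀ j, B j
  | 0 => e 0
  | j + 1 => (eigenValue e μ A J j)⁻¹ • A j (eigenVector e μ A J j)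

namespace NearRankOne

variable {θ : ℝ} {e : ∀ j, B j} {μ : ∀ j, B j →L[ℂ] ℂ} {A₀ A : ∀ j, B j →L[ℂ] B (j + 1)}
  {J : ℕ}

lemma norm_functional_le (H : NearRankOne θ e μ A₀ A J) {j : ℕ} {ν : B j →L[ℂ] ℂ}
    (hν : ‖ν - μ j‖ ≤ θ / 2) : ‖ν‖ ≤ 1 + θ / 2 := by
  have h := norm_add_le (ν - μ j) (μ j)
  rw [sub_add_cancel] at h
  linarith [H.norm_μ j]

/-- Since `A₀ j` maps `e j` to `e (j + 1)`, where `ν` equals one, only the perturbation `A j - A₀ j`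
contributes. The constant `0.06` exceeds `(1 + 0.17 / 2) / 20`. -/
lemma norm_eigenvalue_sub_one_le (H : NearRankOne θ e μ A₀ A J) {j : ℕ}
    {ν : B (j + 1) →L[ℂ] ℂ} (hν : ‖ν - μ (j + 1)‖ ≤ θ / 2) (hν1 : ν (e (j + 1)) = 1) :
    ‖ν (A j (e j)) - 1‖ ≤ 0.06 * θ := by
  have h1 : ν (A j (e j)) - 1 = ν ((A j - A₀ j) (e j)) := by
    simp [H.map_e, hν1]
  have hpos := H.pos
  have hlt := H.lt
  rw [h1]
  calc ‖ν ((A j - A₀ j) (e j))‖ ≤ ‖ν‖ * (‖A j - A₀ j‖ * ‖e j‖) :=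
        (ν.le_opNorm _).trans (mul_le_mul_of_nonneg_left
          ((A j - A₀ j).le_opNorm _) (norm_nonneg _))
    _ ≤ (1 + θ / 2) * (θ / 20 * 1) := by
        have := H.norm_functional_le hν
        have := H.close j
        have := H.norm_e j
        gcongr
    _ ≤ 0.06 * θ := by nlinarith

lemma norm_eigenvalue_ge (H : NearRankOne θ e μ A₀ A J) {l : ℂ} (hl : ‖l - 1‖ ≤ 0.06 * θ) :
    0.98 ≤ ‖l‖ := by
  have h := norm_sub_norm_le (1 : ℂ) l
  rw [norm_one, norm_sub_rev] at h
  linarith [H.lt]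

/-- The inductive step of the backward construction: the `θ / 2`-ball around the `μ j` is stable
under normalized pull-back, because the error `ν - μ (j + 1)` is multiplied by a further small
factor. -/
lemma norm_pullBack_sub_le (H : NearRankOne θ e μ A₀ A J) {j : ℕ}
    {ν : B (j + 1) →L[ℂ] ℂ} (hν : ‖ν - μ (j + 1)‖ ≤ θ / 2) (hν1 : ν (e (j + 1)) = 1) :
    ‖(ν (A j (e j)))⁻¹ • ν.comp (A j) - μ j‖ ≤ θ / 2 := by
  set l := ν (A j (e j)) with hl
  have hpos := H.pos
  have hlt := H.lt
  have hl1 := H.norm_eigenvalue_sub_one_le hν hν1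
  have hl2 := H.norm_eigenvalue_ge hl1
  have hl0 : l ≠ 0 := norm_pos_iff.1 (by linarith)
  -- Both `ν` and `μ (j + 1)` equal one at `e (j + 1)`, so their difference kills the rank one part
  -- and subtracting it from `A₀ j` is free. This makes the first term quadratic in `θ`.
  have e1 : l⁻¹ • ν.comp (A j) - μ j = l⁻¹ • ((ν - μ (j + 1)).comp
      (A₀ j - (μ j).smulRight (e (j + 1))) + ν.comp (A j - A₀ j) - (l - 1) • μ j) := by
    ext g
    have h1 : μ (j + 1) (A₀ j g) = μ j g := by rw [← H.comp_μ j]; rfl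
    simp only [sub_apply, smul_apply,
      ContinuousLinearMap.comp_apply, add_apply,
      ContinuousLinearMap.smulRight_apply, map_sub, map_smul, h1, hν1, H.μ_e, smul_eq_mul]
    field_simp
    ring
  have b1 : ‖(ν - μ (j + 1)).comp (A₀ j - (μ j).smulRight (e (j + 1)))‖ ≤ θ / 2 * (θ / 2) := by
    refine (ContinuousLinearMap.opNorm_comp_le _ _).trans ?_
    have := H.close_rankOne j
    gcongr
  have b2 : ‖ν.comp (A j - A₀ j)‖ ≤ (1 + θ / 2) * (θ / 20) := by
    refine (ContinuousLinearMap.opNorm_comp_le _ _).trans ?_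
    have := H.close j
    have := H.norm_functional_le hν
    gcongr
  have b3 : ‖(l - 1) • μ j‖ ≤ 0.06 * θ * 1 := by
    rw [norm_smul]
    have := H.norm_μ j
    gcongr
  rw [e1, norm_smul, norm_inv, inv_mul_le_iff₀ (by linarith)]
  refine ((norm_sub_le _ _).trans (add_le_add ((norm_add_le _ _).trans (add_le_add b1 b2)) b3)).trans
    ?_
  nlinarith

lemma rawFunctional_succ (H : NearRankOne θ e μ A₀ A J) (j : ℕ) :
    (rawFunctional A μ J (j + 1)).comp (A j) = rawFunctional A μ J j := by
  unfold rawFunctional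
  rcases Nat.lt_or_ge J j with h | h
  · have h1 : J + 1 - j = 0 := by omega
    have h2 : J + 1 - (j + 1) = 0 := by omega
    rw [h1, h2, pullBack, pullBack, H.eq_of_lt j h, H.comp_μ]
  · have h1 : J + 1 - j = (J + 1 - (j + 1)) + 1 := by omega
    rw [h1, pullBack]

lemma eigenFunctional_of_lt (H : NearRankOne θ e μ A₀ A J) {j : ℕ} (h : J < j) :
    eigenFunctional e μ A J j = μ j := by
  have h1 : J + 1 - j = 0 := by omega
  rw [eigenFunctional, rawFunctional, h1, pullBack, H.μ_e, inv_one, one_smul]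

lemma eigenFunctional_eq (H : NearRankOne θ e μ A₀ A J) (j : ℕ)
    (h0 : rawFunctional A μ J (j + 1) (e (j + 1)) ≠ 0) :
    eigenFunctional e μ A J j
      = (eigenValue e μ A J j)⁻¹ • (eigenFunctional e μ A J (j + 1)).comp (A j) := by
  have h1 : rawFunctional A μ J j (e j) = rawFunctional A μ J (j + 1) (A j (e j)) := by
    rw [← H.rawFunctional_succ j]; rfl
  rw [eigenValue, eigenFunctional, eigenFunctional, ContinuousLinearMap.smul_comp,
    H.rawFunctional_succ j, smul_smul, smul_apply, h1]
  congr 1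
  rw [smul_eq_mul, mul_inv, inv_inv, mul_right_comm, mul_inv_cancel₀ h0, one_mul]

/-- Induction on the distance to `J + 1`, where the functional is `μ j` itself. Nonvanishing and
closeness have to be carried together: closeness at `j + 1` keeps the eigenvalue at `j` away from
zero, which gives nonvanishing at `j`. -/
lemma functional_aux (H : NearRankOne θ e μ A₀ A J) (n j : ℕ) (hn : J + 1 - j = n) :
    rawFunctional A μ J j (e j) ≠ 0 ∧ ‖eigenFunctional e μ A J j - μ j‖ ≤ θ / 2 := by
  induction n generalizing j with
  | zero =>
    refine ⟨?_, ?_⟩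
    · rw [rawFunctional, hn, pullBack, H.μ_e]
      exact one_ne_zero
    · rw [H.eigenFunctional_of_lt (by omega), sub_self, norm_zero]
      linarith [H.pos]
  | succ n ih =>
    obtain ⟨h0, h1⟩ := ih (j + 1) (by omega)
    have hone : eigenFunctional e μ A J (j + 1) (e (j + 1)) = 1 := by
      simp [eigenFunctional, h0]
    have hl := H.norm_eigenvalue_ge (H.norm_eigenvalue_sub_one_le h1 hone)
    refine ⟨?_, ?_⟩
    · rw [← H.rawFunctional_succ j]
      intro hc
      rw [eigenFunctional, smul_apply,
        show rawFunctional A μ J (j + 1) (A j (e j)) = 0 from hc, smul_zero, norm_zero] at hl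
      norm_num at hl
    · rw [H.eigenFunctional_eq j h0]
      exact H.norm_pullBack_sub_le h1 hone

lemma rawFunctional_ne_zero (H : NearRankOne θ e μ A₀ A J) (j : ℕ) :
    rawFunctional A μ J j (e j) ≠ 0 := (H.functional_aux _ j rfl).1

lemma norm_eigenFunctional_sub_le (H : NearRankOne θ e μ A₀ A J) (j : ℕ) :
    ‖eigenFunctional e μ A J j - μ j‖ ≤ θ / 2 := (H.functional_aux _ j rfl).2

lemma eigenFunctional_e (H : NearRankOne θ e μ A₀ A J) (j : ℕ) :
    eigenFunctional e μ A J j (e j) = 1 := by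
  simp [eigenFunctional, H.rawFunctional_ne_zero j]

lemma norm_eigenFunctional_le (H : NearRankOne θ e μ A₀ A J) (j : ℕ) :
    ‖eigenFunctional e μ A J j‖ ≤ 1.1 := by
  linarith [H.norm_functional_le (H.norm_eigenFunctional_sub_le j), H.lt]

lemma norm_eigenValue_sub_one_le (H : NearRankOne θ e μ A₀ A J) (j : ℕ) :
    ‖eigenValue e μ A J j - 1‖ ≤ 0.06 * θ :=
  H.norm_eigenvalue_sub_one_le (H.norm_eigenFunctional_sub_le (j + 1)) (H.eigenFunctional_e (j + 1))

lemma norm_eigenValue_ge (H : NearRankOne θ e μ A₀ A J) (j : ℕ) :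
    0.98 ≤ ‖eigenValue e μ A J j‖ :=
  H.norm_eigenvalue_ge (H.norm_eigenValue_sub_one_le j)

lemma eigenValue_ne_zero (H : NearRankOne θ e μ A₀ A J) (j : ℕ) :
    eigenValue e μ A J j ≠ 0 :=
  norm_pos_iff.1 (by linarith [H.norm_eigenValue_ge j])

lemma norm_eigenValue_le (H : NearRankOne θ e μ A₀ A J) (j : ℕ) :
    ‖eigenValue e μ A J j‖ ≤ 2 := by
  have h := norm_add_le (eigenValue e μ A J j - 1) 1
  rw [sub_add_cancel, norm_one] at h
  linarith [H.norm_eigenValue_sub_one_le j, H.lt]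

lemma eigenFunctional_comp (H : NearRankOne θ e μ A₀ A J) (j : ℕ) :
    (eigenFunctional e μ A J (j + 1)).comp (A j)
      = eigenValue e μ A J j • eigenFunctional e μ A J j := by
  rw [H.eigenFunctional_eq j (H.rawFunctional_ne_zero _), smul_smul,
    mul_inv_cancel₀ (H.eigenValue_ne_zero j), one_smul]

lemma map_eigenVector (H : NearRankOne θ e μ A₀ A J) (j : ℕ) :
    A j (eigenVector e μ A J j) = eigenValue e μ A J j • eigenVector e μ A J (j + 1) := by
  rw [eigenVector, smul_smul, mul_inv_cancel₀ (H.eigenValue_ne_zero j), one_smul]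

lemma eigenFunctional_eigenVector (H : NearRankOne θ e μ A₀ A J) (j : ℕ) :
    eigenFunctional e μ A J j (eigenVector e μ A J j) = 1 := by
  induction j with
  | zero => exact H.eigenFunctional_e 0
  | succ j ih =>
    have h := congrArg (fun F => F (eigenVector e μ A J j)) (H.eigenFunctional_comp j)
    simp only [ContinuousLinearMap.comp_apply, smul_apply, ih] at h
    rw [eigenVector, map_smul, h, smul_eq_mul, smul_eq_mul, mul_one,
      inv_mul_cancel₀ (H.eigenValue_ne_zero j)]

/-- On the kernel of the eigenfunctional `μ j` is small, since it equals minus the difference of the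
two functionals there. Hence the rank one part of `A j` is small as well, and the total `1.05 * θ`
stays below `2 * θ` after division by an eigenvalue of modulus at least `0.98`. -/
lemma norm_map_le (H : NearRankOne θ e μ A₀ A J) {j : ℕ} {g : B j}
    (hg : eigenFunctional e μ A J j g = 0) :
    ‖(eigenValue e μ A J j)⁻¹ • A j g‖ ≤ 2 * θ * ‖g‖ := by
  have hpos := H.pos
  have hl := H.norm_eigenValue_ge j
  have e1 : A j g = (A j - A₀ j) g + (A₀ j - (μ j).smulRight (e (j + 1))) g
      - (eigenFunctional e μ A J j - μ j) g • e (j + 1) := by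
    simp [hg]
  have b1 : ‖(A j - A₀ j) g‖ ≤ θ / 20 * ‖g‖ :=
    ((A j - A₀ j).le_opNorm g).trans (mul_le_mul_of_nonneg_right (H.close j) (norm_nonneg _))
  have b2 : ‖(A₀ j - (μ j).smulRight (e (j + 1))) g‖ ≤ θ / 2 * ‖g‖ :=
    (ContinuousLinearMap.le_opNorm _ g).trans
      (mul_le_mul_of_nonneg_right (H.close_rankOne j) (norm_nonneg _))
  have b3 : ‖(eigenFunctional e μ A J j - μ j) g • e (j + 1)‖ ≤ θ / 2 * ‖g‖ * 1 := by
    rw [norm_smul]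
    refine mul_le_mul ((ContinuousLinearMap.le_opNorm _ g).trans
      (mul_le_mul_of_nonneg_right (H.norm_eigenFunctional_sub_le j) (norm_nonneg _)))
      (H.norm_e _) (norm_nonneg _) (by positivity)
  have b4 : ‖A j g‖ ≤ θ / 20 * ‖g‖ + θ / 2 * ‖g‖ + θ / 2 * ‖g‖ * 1 := by
    rw [e1]
    exact (norm_sub_le _ _).trans (add_le_add ((norm_add_le _ _).trans (add_le_add b1 b2)) b3)
  rw [norm_smul, norm_inv, inv_mul_le_iff₀ (by linarith)]
  have h2 : 0 ≤ θ * ‖g‖ := by positivity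
  nlinarith

/-- The deviation from `e j` lies in the kernel of the eigenfunctional, so it is contracted by `2 *
θ` at each step while an error of at most `0.2 * θ` is added. The bound `1` persists because `2.2 *
θ < 1`. -/
lemma norm_eigenVector_sub_le (H : NearRankOne θ e μ A₀ A J) (j : ℕ) :
    ‖eigenVector e μ A J j - e j‖ ≤ 1 := by
  induction j with
  | zero => simp [eigenVector]
  | succ j ih =>
    have hpos := H.pos
    have hlt := H.lt
    have hl := H.norm_eigenValue_ge j
    have hl0 := H.eigenValue_ne_zero j
    set l := eigenValue e μ A J j with hldef
    have hk : eigenFunctional e μ A J j (eigenVector e μ A J j - e j) = 0 := by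
      rw [map_sub, H.eigenFunctional_eigenVector, H.eigenFunctional_e, sub_self]
    have b1 := H.norm_map_le hk
    have e1 : eigenVector e μ A J (j + 1) - e (j + 1)
        = l⁻¹ • A j (eigenVector e μ A J j - e j)
          + l⁻¹ • ((A j - A₀ j) (e j) - (l - 1) • e (j + 1)) := by
      rw [eigenVector, ← hldef, map_sub, sub_apply, H.map_e, sub_smul, one_smul,
        smul_sub, smul_sub, smul_sub, smul_sub, smul_smul l⁻¹ l, inv_mul_cancel₀ hl0, one_smul]
      abel
    have b2 : ‖(A j - A₀ j) (e j)‖ ≤ θ / 20 * 1 :=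
      ((A j - A₀ j).le_opNorm _).trans
        (mul_le_mul (H.close j) (H.norm_e j) (norm_nonneg _) (by positivity))
    have b3 : ‖(l - 1) • e (j + 1)‖ ≤ 0.06 * θ * 1 := by
      rw [norm_smul]
      exact mul_le_mul (H.norm_eigenValue_sub_one_le j) (H.norm_e _) (norm_nonneg _) (by positivity)
    have b4 : ‖l⁻¹ • ((A j - A₀ j) (e j) - (l - 1) • e (j + 1))‖ ≤ 0.2 * θ := by
      rw [norm_smul, norm_inv, inv_mul_le_iff₀ (by linarith)]
      refine ((norm_sub_le _ _).trans (add_le_add b2 b3)).trans ?_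
      nlinarith
    rw [e1]
    refine ((norm_add_le _ _).trans (add_le_add b1 b4)).trans ?_
    nlinarith

lemma norm_eigenVector_le (H : NearRankOne θ e μ A₀ A J) (j : ℕ) :
    ‖eigenVector e μ A J j‖ ≤ 2 := by
  have h := norm_add_le (eigenVector e μ A J j - e j) (e j)
  rw [sub_add_cancel] at h
  linarith [H.norm_eigenVector_sub_le j, H.norm_e j]

lemma seqIter_eigenVector (j n : ℕ) :
    (∏ k ∈ Finset.range n, eigenValue e μ A J (j + k))⁻¹ •
      seqIter A j n (eigenVector e μ A J j) = eigenVector e μ A J (j + n) := by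
  induction n with
  | zero => simp [seqIter]
  | succ n ih =>
    change _ = (eigenValue e μ A J (j + n))⁻¹ • A (j + n) (eigenVector e μ A J (j + n))
    rw [← ih, Finset.prod_range_succ, mul_inv_rev, mul_smul, seqIter, map_smul]
    rfl

lemma norm_seqIter_le (H : NearRankOne θ e μ A₀ A J) (j n : ℕ) {g : B j}
    (hg : eigenFunctional e μ A J j g = 0) :
    eigenFunctional e μ A J (j + n)
        ((∏ k ∈ Finset.range n, eigenValue e μ A J (j + k))⁻¹ • seqIter A j n g) = 0 ∧
      ‖(∏ k ∈ Finset.range n, eigenValue e μ A J (j + k))⁻¹ • seqIter A j n g‖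
        ≤ (2 * θ) ^ n * ‖g‖ := by
  induction n with
  | zero => simpa [seqIter] using hg
  | succ n ih =>
    obtain ⟨h1, h2⟩ := ih
    have hpos := H.pos
    have e1 : (∏ k ∈ Finset.range (n + 1), eigenValue e μ A J (j + k))⁻¹ • seqIter A j (n + 1) g
        = (eigenValue e μ A J (j + n))⁻¹ • A (j + n)
          ((∏ k ∈ Finset.range n, eigenValue e μ A J (j + k))⁻¹ • seqIter A j n g) := by
      rw [Finset.prod_range_succ, mul_inv_rev, mul_smul, seqIter, map_smul]
      rfl
    rw [e1]
    refine ⟨?_, ?_⟩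
    · have h := congrArg (fun F => F ((∏ k ∈ Finset.range n,
        eigenValue e μ A J (j + k))⁻¹ • seqIter A j n g)) (H.eigenFunctional_comp (j + n))
      simp only [ContinuousLinearMap.comp_apply, smul_apply, h1,
        smul_zero] at h
      refine (map_smul (eigenFunctional e μ A J (j + n + 1)) _ _).trans ?_
      rw [h, smul_zero]
    · refine (H.norm_map_le h1).trans ?_
      rw [pow_succ', mul_assoc (2 * θ)]
      exact mul_le_mul_of_nonneg_left h2 (by positivity)

/-- The eigenvector component of `g` is transported exactly; what remains is the kernel component,
of norm at most `(1 + 1.1 * 2) * ‖g‖`. -/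
lemma norm_seqIter_sub_le (H : NearRankOne θ e μ A₀ A J) (j n : ℕ) :
    ‖(∏ k ∈ Finset.range n, eigenValue e μ A J (j + k))⁻¹ • seqIter A j n
        - (eigenFunctional e μ A J j).smulRight (eigenVector e μ A J (j + n))‖
      ≤ 4 * (2 * θ) ^ n := by
  have hpos := H.pos
  refine ContinuousLinearMap.opNorm_le_bound _ (by positivity) fun g => ?_
  set k : B j := g - eigenFunctional e μ A J j g • eigenVector e μ A J j with hk
  have hk0 : eigenFunctional e μ A J j k = 0 := by
    rw [hk, map_sub, map_smul, H.eigenFunctional_eigenVector, smul_eq_mul, mul_one, sub_self]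
  have hkn : ‖k‖ ≤ 4 * ‖g‖ := by
    have h1 : ‖eigenFunctional e μ A J j g • eigenVector e μ A J j‖ ≤ 1.1 * ‖g‖ * 2 := by
      rw [norm_smul]
      exact mul_le_mul (ContinuousLinearMap.le_of_opNorm_le _ (H.norm_eigenFunctional_le j) g)
        (H.norm_eigenVector_le j) (norm_nonneg _) (by positivity)
    have := norm_nonneg g
    refine (norm_sub_le _ _).trans ?_
    linarith
  have e1 : ((∏ k ∈ Finset.range n, eigenValue e μ A J (j + k))⁻¹ • seqIter A j n
        - (eigenFunctional e μ A J j).smulRight (eigenVector e μ A J (j + n))) g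
      = (∏ k ∈ Finset.range n, eigenValue e μ A J (j + k))⁻¹ • seqIter A j n k := by
    rw [sub_apply, smul_apply,
      ContinuousLinearMap.smulRight_apply, ← seqIter_eigenVector j n, hk, map_sub, map_smul,
      smul_sub, smul_comm (eigenFunctional e μ A J j g)]
  rw [e1]
  refine (H.norm_seqIter_le j n hk0).2.trans ?_
  calc (2 * θ) ^ n * ‖k‖ ≤ (2 * θ) ^ n * (4 * ‖g‖) := by gcongr
    _ = _ := by ring

/-- For the unperturbed operators the triplet is `(1, e j, μ j)`. -/
lemma triplet_self (H : NearRankOne θ e μ A₀ A J) (j : ℕ) :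
    eigenFunctional e μ A₀ J j = μ j ∧ eigenValue e μ A₀ J j = 1 ∧
      eigenVector e μ A₀ J j = e j := by
  have h1 : ∀ n j, pullBack A₀ μ n j = μ j := by
    intro n
    induction n with
    | zero => exact fun j => rfl
    | succ n ih => exact fun j => by rw [pullBack, ih, H.comp_μ]
  have h2 : ∀ j, eigenFunctional e μ A₀ J j = μ j := fun j => by
    rw [eigenFunctional, rawFunctional, h1, H.μ_e, inv_one, one_smul]
  have h3 : ∀ j, eigenValue e μ A₀ J j = 1 := fun j => by
    rw [eigenValue, h2, H.map_e, H.μ_e]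
  refine ⟨h2 j, h3 j, ?_⟩
  induction j with
  | zero => rfl
  | succ j ih => rw [eigenVector, h3, ih, H.map_e, inv_one, one_smul]

end NearRankOne

/-! ### Analytic dependence of the triplets on the parameter -/

section Analytic

variable {A : ℂ → ∀ j, B j →L[ℂ] B (j + 1)} {e : ∀ j, B j} {μ : ∀ j, B j →L[ℂ] ℂ} {z : ℂ}

lemma analyticAt_clm_comp {E F G : Type*} [NormedAddCommGroup E] [NormedSpace ℂ E]
    [NormedAddCommGroup F] [NormedSpace ℂ F] [NormedAddCommGroup G] [NormedSpace ℂ G]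
    {f : ℂ → F →L[ℂ] G} {g : ℂ → E →L[ℂ] F} (hf : AnalyticAt ℂ f z) (hg : AnalyticAt ℂ g z) :
    AnalyticAt ℂ (fun w => (f w).comp (g w)) z :=
  ((ContinuousLinearMap.compL ℂ E F G).analyticAt_bilinear (f z, g z)).comp₂ hf hg

lemma analyticAt_clm_apply {E F : Type*} [NormedAddCommGroup E] [NormedSpace ℂ E]
    [NormedAddCommGroup F] [NormedSpace ℂ F] {f : ℂ → E →L[ℂ] F} {g : ℂ → E}
    (hf : AnalyticAt ℂ f z) (hg : AnalyticAt ℂ g z) :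
    AnalyticAt ℂ (fun w => f w (g w)) z :=
  ((ContinuousLinearMap.apply ℂ F).analyticAt_bilinear (g z, f z)).comp₂ hg hf

lemma analyticAt_seqIter (hA : ∀ j, AnalyticAt ℂ (fun w => A w j) z) (j n : ℕ) :
    AnalyticAt ℂ (fun w => seqIter (A w) j n) z := by
  induction n with
  | zero => exact analyticAt_const
  | succ n ih => exact analyticAt_clm_comp (hA (j + n)) ih

/-- The number of composed operators depends on `J` and `j` only, not on the parameter. -/
lemma analyticAt_rawFunctional (hA : ∀ j, AnalyticAt ℂ (fun w => A w j) z) (J j : ℕ) :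
    AnalyticAt ℂ (fun w => rawFunctional (A w) μ J j) z := by
  unfold rawFunctional
  generalize J + 1 - j = n
  induction n generalizing j with
  | zero => exact analyticAt_const
  | succ n ih => exact analyticAt_clm_comp (ih (j + 1)) (hA j)

lemma analyticAt_eigenFunctional (hA : ∀ j, AnalyticAt ℂ (fun w => A w j) z) {J j : ℕ}
    (h0 : rawFunctional (A z) μ J j (e j) ≠ 0) :
    AnalyticAt ℂ (fun w => eigenFunctional e μ (A w) J j) z :=
  ((analyticAt_clm_apply (analyticAt_rawFunctional hA J j) analyticAt_const).inv h0).smul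
    (analyticAt_rawFunctional hA J j)

lemma analyticAt_eigenValue (hA : ∀ j, AnalyticAt ℂ (fun w => A w j) z) {J j : ℕ}
    (h0 : rawFunctional (A z) μ J (j + 1) (e (j + 1)) ≠ 0) :
    AnalyticAt ℂ (fun w => eigenValue e μ (A w) J j) z :=
  analyticAt_clm_apply (analyticAt_eigenFunctional hA h0)
    (analyticAt_clm_apply (hA j) analyticAt_const)

lemma analyticAt_eigenVector (hA : ∀ j, AnalyticAt ℂ (fun w => A w j) z) {J : ℕ}
    (h0 : ∀ j, rawFunctional (A z) μ J j (e j) ≠ 0)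
    (h1 : ∀ j, eigenValue e μ (A z) J j ≠ 0) (j : ℕ) :
    AnalyticAt ℂ (fun w => eigenVector e μ (A w) J j) z := by
  induction j with
  | zero => exact analyticAt_const
  | succ j ih =>
    exact ((analyticAt_eigenValue hA (h0 (j + 1))).inv (h1 j)).smul
      (analyticAt_clm_apply (hA j) ih)

end Analytic

/-- Triplets for an analytic family of operators close to rank one projections. -/
theorem exists_triplets {θ : ℝ} {e : ∀ j, B j} {μ : ∀ j, B j →L[ℂ] ℂ}
    {A : ℂ → ∀ j, B j →L[ℂ] B (j + 1)} {J : ℕ} {V : Set ℂ} (h0 : (0 : ℂ) ∈ V)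
    (hA : ∀ j, ∀ z ∈ V, AnalyticAt ℂ (fun w => A w j) z)
    (H : ∀ z ∈ V, NearRankOne θ e μ (A 0) (A z) J) :
    ∃ (lam : ℕ → ℂ → ℂ) (h : ∀ j, ℂ → B j) (ν : ∀ j, ℂ → (B j →L[ℂ] ℂ)),
      (∀ j, AnalyticOnNhd ℂ (lam j) V ∧ AnalyticOnNhd ℂ (h j) V ∧ AnalyticOnNhd ℂ (ν j) V) ∧
      (∀ j, ∀ z ∈ V, lam j z ≠ 0 ∧ ‖lam j z‖ ≤ 2 ∧ ‖h j z‖ ≤ 2 ∧ ‖ν j z‖ ≤ 2) ∧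
      (∀ j, lam j 0 = 1 ∧ h j 0 = e j ∧ ν j 0 = μ j) ∧
      (∀ j, ∀ z ∈ V, ν j z (e j) = 1 ∧ ν j z (h j z) = 1) ∧
      (∀ j, ∀ z ∈ V, A z j (h j z) = lam j z • h (j + 1) z ∧
        (ν (j + 1) z).comp (A z j) = lam j z • ν j z) ∧
      (∀ j n, ∀ z ∈ V,
        ‖(∏ k ∈ Finset.range n, lam (j + k) z)⁻¹ • seqIter (A z) j n
          - (ν j z).smulRight (h (j + n) z)‖ ≤ 4 * (2 * θ) ^ n) := by
  refine ⟨fun j z => eigenValue e μ (A z) J j, fun j z => eigenVector e μ (A z) J j,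
    fun j z => eigenFunctional e μ (A z) J j, fun j => ⟨fun z hz => ?_, fun z hz => ?_,
    fun z hz => ?_⟩, fun j z hz => ⟨(H z hz).eigenValue_ne_zero j, (H z hz).norm_eigenValue_le j,
      (H z hz).norm_eigenVector_le j, ((H z hz).norm_eigenFunctional_le j).trans (by norm_num)⟩,
    fun j => ?_, fun j z hz => ⟨(H z hz).eigenFunctional_e j,
      (H z hz).eigenFunctional_eigenVector j⟩,
    fun j z hz => ⟨(H z hz).map_eigenVector j, (H z hz).eigenFunctional_comp j⟩,
    fun j n z hz => (H z hz).norm_seqIter_sub_le j n⟩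
  · exact analyticAt_eigenValue (fun j => hA j z hz) ((H z hz).rawFunctional_ne_zero _)
  · exact analyticAt_eigenVector (fun j => hA j z hz) (H z hz).rawFunctional_ne_zero
      (H z hz).eigenValue_ne_zero j
  · exact analyticAt_eigenFunctional (fun j => hA j z hz) ((H z hz).rawFunctional_ne_zero _)
  · obtain ⟨t1, t2, t3⟩ := (H 0 h0).triplet_self j
    exact ⟨t2, t3, t1⟩

end Perturbation

/-! ### Completeness of the Hölder space and exponentials of multiplication operators -/

section Holder

namespace HolderSpace

variable {X : Type*} [MetricSpace X] {α : ℝ}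

@[simp] lemma one_apply (x : X) : (one : HolderSpace α X) x = 1 := rfl

/-- Evaluation at a point. -/
def evalCLM (x : X) : HolderSpace α X →L[ℂ] ℂ :=
  LinearMap.mkContinuous
    { toFun := fun g => g x
      map_add' := fun _ _ => rfl
      map_smul' := fun _ _ => rfl } 1
    (fun g => by rw [one_mul]; exact g.isHolder.norm_le x)

lemma norm_one_le : ‖(one : HolderSpace α X)‖ ≤ 1 := by
  have h := holderNorm_le_add (α := α) (g := ((one : HolderSpace α X) : X → ℂ))
    zero_le_one le_rfl (fun x => by simp) (fun x y => by simp)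
  rwa [add_zero] at h

/-- Completeness is needed for the convergence of exponential series of operators on this space. -/
instance : CompleteSpace (HolderSpace α X) := by
  refine Metric.complete_of_cauchySeq_tendsto fun u hu => ?_
  have hx : ∀ x, CauchySeq fun n => u n x := fun x =>
    hu.map (evalCLM (α := α) x).uniformContinuous
  choose g hg using fun x => cauchySeq_tendsto_of_complete (hx x)
  -- The sup bound and the Hölder bound are closed under pointwise limits, so a norm bound on `u n -
  -- u m` for large `m` passes to both halves of the norm of `u n - g`.
  have hlim : ∀ (C : ℝ) (n : ℕ), (∀ᶠ m in Filter.atTop, ‖u n - u m‖ ≤ C) →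
      (∀ x, ‖u n x - g x‖ ≤ C) ∧
      ∀ x y, ‖(u n x - g x) - (u n y - g y)‖ ≤ C * dist x y ^ α := by
    intro C n hC
    refine ⟨fun x => ?_, fun x y => ?_⟩
    · refine le_of_tendsto ((tendsto_const_nhds.sub (hg x)).norm) ?_
      filter_upwards [hC] with m hm
      exact ((u n - u m).isHolder.norm_le x).trans hm
    · refine le_of_tendsto (((tendsto_const_nhds.sub (hg x)).sub
        (tendsto_const_nhds.sub (hg y))).norm) ?_
      filter_upwards [hC] with m hm
      exact ((u n - u m).isHolder.norm_sub_le x y).trans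
        (mul_le_mul_of_nonneg_right hm (Real.rpow_nonneg dist_nonneg α))
  have hev : ∀ C > 0, ∀ᶠ n in Filter.atTop, ∀ᶠ m in Filter.atTop, ‖u n - u m‖ ≤ C := by
    intro C hC
    obtain ⟨N, hN⟩ := Metric.cauchySeq_iff.1 hu C hC
    filter_upwards [Filter.eventually_ge_atTop N] with n hn
    filter_upwards [Filter.eventually_ge_atTop N] with m hm
    rw [← dist_eq_norm]
    exact (hN n hn m hm).le
  have hd : ∀ (C : ℝ) (n : ℕ), (∀ᶠ m in Filter.atTop, ‖u n - u m‖ ≤ C) →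
      IsHolder α fun x => u n x - g x := fun C n h => ⟨C, (hlim C n h).1, (hlim C n h).2⟩
  have hgH : IsHolder α g := by
    obtain ⟨n, hn⟩ := (hev 1 one_pos).exists
    have h := (u n).isHolder.add ((hd 1 n hn).smul (-1))
    have e : g = (u n : X → ℂ) + (-1 : ℂ) • fun x => u n x - g x := by
      funext x
      simp
    rw [e]
    exact h
  refine ⟨mk g hgH, ?_⟩
  rw [tendsto_iff_norm_sub_tendsto_zero, Metric.tendsto_atTop]
  intro r hr
  obtain ⟨N, hN⟩ := Filter.eventually_atTop.1 (hev (r / 3) (by linarith))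
  refine ⟨N, fun n hn => ?_⟩
  obtain ⟨h1, h2⟩ := hlim _ n (hN n hn)
  have h := holderNorm_le_add (by linarith) (by linarith) h1 h2
  rw [Real.dist_eq, sub_zero, abs_norm]
  refine lt_of_le_of_lt h ?_
  linarith

/-- Multiplication by a bounded Hölder function. -/
def mulCLM (u : X → ℂ) (hu : IsHolder α u) : HolderSpace α X →L[ℂ] HolderSpace α X :=
  have key : ∃ C : ℝ, 0 ≤ C ∧ ∀ g : HolderSpace α X, (∀ x, ‖u x * g x‖ ≤ C * ‖g‖) ∧
      ∀ x y, ‖u x * g x - u y * g y‖ ≤ (2 * C * ‖g‖) * dist x y ^ α := by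
    obtain ⟨C, h0, h1, h2⟩ := hu.exists_nonneg
    refine ⟨C, h0, fun g => ⟨fun x => ?_, fun x y => ?_⟩⟩
    · rw [norm_mul]
      exact mul_le_mul (h1 x) (g.isHolder.norm_le x) (norm_nonneg _) h0
    · have e1 : u x * g x - u y * g y = u x * (g x - g y) + (u x - u y) * g y := by ring
      have hd := Real.rpow_nonneg (dist_nonneg (x := x) (y := y)) α
      have b1 : ‖u x * (g x - g y)‖ ≤ C * (‖g‖ * dist x y ^ α) := by
        rw [norm_mul]
        exact mul_le_mul (h1 x) (g.isHolder.norm_sub_le x y) (norm_nonneg _) h0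
      have b2 : ‖(u x - u y) * g y‖ ≤ C * dist x y ^ α * ‖g‖ := by
        rw [norm_mul]
        exact mul_le_mul (h2 x y) (g.isHolder.norm_le y) (norm_nonneg _) (by positivity)
      rw [e1]
      calc _ ≤ _ := norm_add_le _ _
        _ ≤ _ := add_le_add b1 b2
        _ = _ := by ring
  LinearMap.mkContinuousOfExistsBound
    { toFun := fun g => mk (fun x => u x * g x) (by
        obtain ⟨C, h0, hC⟩ := key
        refine ⟨2 * C * ‖g‖, fun x => ((hC g).1 x).trans ?_, (hC g).2⟩
        have := mul_nonneg h0 (norm_nonneg g)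
        linarith)
      map_add' := fun g k => by ext x; simp [mul_add]
      map_smul' := fun c g => by ext x; simp [mul_left_comm] }
    (by
      obtain ⟨C, h0, hC⟩ := key
      refine ⟨C + 2 * C, fun g => ?_⟩
      rw [add_mul]
      exact holderNorm_le_add (by positivity) (by positivity) (hC g).1 (hC g).2)

lemma mulCLM_apply (u : X → ℂ) (hu : IsHolder α u) (g : HolderSpace α X) (x : X) :
    mulCLM u hu g x = u x * g x := rfl

lemma mulCLM_pow_apply (u : X → ℂ) (hu : IsHolder α u) (n : ℕ) (g : HolderSpace α X) (x : X) :
    (mulCLM u hu ^ n) g x = u x ^ n * g x := by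
  induction n generalizing g with
  | zero => simp
  | succ n ih =>
    rw [pow_succ]
    change (mulCLM u hu ^ n) (mulCLM u hu g) x = _
    rw [ih, mulCLM_apply, pow_succ, mul_assoc]

/-- Applying an operator to `g` and evaluating at `x` is continuous and linear, so it turns the
operator exponential series into the scalar one. -/
lemma exp_smul_mulCLM_apply (u : X → ℂ) (hu : IsHolder α u) (z : ℂ) (g : HolderSpace α X)
    (x : X) : NormedSpace.exp (z • mulCLM u hu) g x = Complex.exp (z * u x) * g x := by
  have h1 := NormedSpace.exp_series_hasSum_exp' (𝕂 := ℂ) (z • mulCLM u hu)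
  have h2 := h1.mapL ((evalCLM (α := α) x).comp
    (ContinuousLinearMap.apply ℂ (HolderSpace α X) g))
  have h3 := (NormedSpace.exp_series_hasSum_exp' (𝕂 := ℂ) (z * u x)).mul_right (g x)
  rw [← Complex.exp_eq_exp_ℂ] at h3
  refine h2.unique
    ((congrArg (fun F => HasSum F (Complex.exp (z * u x) * g x)) (funext fun n => ?_)).mpr h3)
  change (((n.factorial : ℂ)⁻¹ • (z • mulCLM u hu) ^ n) g) x = _
  rw [smul_pow]
  change (n.factorial : ℂ)⁻¹ * (z ^ n * (mulCLM u hu ^ n) g x) = _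
  rw [mulCLM_pow_apply, smul_eq_mul, mul_pow]
  ring

end HolderSpace

end Holder

/-! ### Analyticity and normalization of the transfer operators -/

namespace ExpandingSequence

variable {X : ℕ → Type*} [∀ j, MetricSpace (X j)] [∀ j, MeasurableSpace (X j)]
  [∀ j, BorelSpace (X j)] {α : ℝ} (S : ExpandingSequence X α)

/-- All dependence on `z` is moved into an exponential in a Banach algebra, which is entire. -/
lemma transfer_eq_comp_exp (j : ℕ) (z : ℂ) :
    S.transfer j z = (S.transfer j 0).comp
      (NormedSpace.exp (z • HolderSpace.mulCLM _ (S.isHolder_f j).ofReal)) := by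
  ext g x
  rw [ContinuousLinearMap.comp_apply, transfer_apply, transfer_apply]
  refine finsum_congr fun y => ?_
  rw [HolderSpace.exp_smul_mulCLM_apply, zero_mul, add_zero, Complex.exp_add, mul_assoc]

lemma analyticAt_transfer (j : ℕ) (z : ℂ) : AnalyticAt ℂ (S.transfer j) z := by
  rw [show S.transfer j = fun w => (S.transfer j 0).comp
    (NormedSpace.exp (w • HolderSpace.mulCLM _ (S.isHolder_f j).ofReal)) from
    funext (S.transfer_eq_comp_exp j)]
  refine analyticAt_clm_comp analyticAt_const ?_
  exact (NormedSpace.exp_analytic (𝕂 := ℂ) _).comp (analyticAt_id.smul analyticAt_const)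

lemma transfer_one (j : ℕ) : S.transfer j 0 HolderSpace.one = HolderSpace.one := by
  ext x
  have := Fintype.ofFinite ↥(S.T j ⁻¹' {x})
  have h := S.normalized j x
  rw [finsum_eq_sum_of_fintype] at h
  rw [transfer_apply, finsum_eq_sum_of_fintype]
  simp only [zero_mul, add_zero, HolderSpace.one_apply, mul_one]
  exact_mod_cast congrArg ((↑) : ℝ → ℂ) h

lemma seqIter_transfer_one (j n : ℕ) :
    seqIter (fun i => S.transfer i 0) j n HolderSpace.one = HolderSpace.one := by
  induction n with
  | zero => rfl
  | succ n ih => rw [seqIter, ContinuousLinearMap.comp_apply, ih]; exact S.transfer_one (j + n)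

lemma norm_meas_le (j : ℕ) : ‖S.meas j‖ ≤ 1 :=
  LinearMap.mkContinuous_norm_le _ zero_le_one _

lemma meas_one (j : ℕ) : S.meas j HolderSpace.one = 1 := by
  have := S.isProbabilityMeasure j
  simp [meas_apply]

end ExpandingSequence

-- Comparison of perturbed and unperturbed iterates

universe u

namespace ExpandingSequence

variable {X : ℕ → Type u} [∀ j, MetricSpace (X j)] [∀ j, MeasurableSpace (X j)]
  [∀ j, BorelSpace (X j)] {α : ℝ} (S : ExpandingSequence X α)

/-- A bound for the supremum of the Birkhoff sum `f_s + ⋯ + f_{s+n-1} ∘ T_s^{n-1}`. -/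
def birkhoffSup (s n : ℕ) : ℝ := ∑ k ∈ Finset.range n, holderNorm α (S.f (s + k))

/-- A bound for the Hölder constant, along paired preimages, of Birkhoff sums of functions with
Hölder norms `v k`. -/
def birkhoffVar (v : ℕ → ℝ) (s n : ℕ) : ℝ :=
  ∑ k ∈ Finset.range n, v (s + k) * ∏ i ∈ Finset.Ico k n, S.γ (s + i) ^ (-α)

/-- One more map contracts all earlier variations, including that of the newest summand, which is
evaluated at preimages of the end point. -/
lemma birkhoffVar_succ (v : ℕ → ℝ) (s n : ℕ) :
    S.birkhoffVar v s (n + 1) = (S.birkhoffVar v s n + v (s + n)) * S.γ (s + n) ^ (-α) := by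
  unfold birkhoffVar
  rw [Finset.sum_range_succ, add_mul, Finset.sum_mul]
  congr 1
  · refine Finset.sum_congr rfl fun k hk => ?_
    rw [Finset.prod_Ico_succ_top (Finset.mem_range.1 hk).le, mul_assoc]
  · simp

lemma γ_pos (j : ℕ) : 0 < S.γ j := zero_lt_one.trans_le (S.one_le_γ j)

lemma birkhoffVar_nonneg {v : ℕ → ℝ} (hv : ∀ k, 0 ≤ v k) (s n : ℕ) : 0 ≤ S.birkhoffVar v s n :=
  Finset.sum_nonneg fun _ _ => mul_nonneg (hv _)
    (Finset.prod_nonneg fun _ _ => Real.rpow_nonneg (S.γ_pos _).le _)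

lemma birkhoffSup_nonneg (s n : ℕ) : 0 ≤ S.birkhoffSup s n :=
  Finset.sum_nonneg fun _ _ => holderNorm_nonneg _ _

lemma transfer_apply_eq_sum (j : ℕ) (z : ℂ) (g : HolderSpace α (X j)) (x : X (j + 1))
    [Fintype ↥(S.T j ⁻¹' {x})] :
    S.transfer j z g x = ∑ y : ↥(S.T j ⁻¹' {x}),
      Complex.exp ((S.φ j y : ℂ) + z * (S.f j y : ℂ)) * g y := by
  rw [transfer_apply, finsum_eq_sum_of_fintype]

/-- Nearby points have paired preimages under `T_{s+n-1} ∘ ⋯ ∘ T_s`; `a`, `b` are the values of the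
Birkhoff sums of `φ` and `f` at the preimages. -/
lemma exists_paired_preimages (s n : ℕ) (x x' : X (s + n)) (hx : dist x x' ≤ S.ξ (s + n)) :
    ∃ (ι : Type u) (_ : Fintype ι) (y y' : ι → X s) (a a' b b' : ι → ℝ),
      (∀ z g, seqIter (fun i => S.transfer i z) s n g x
        = ∑ i, Complex.exp ((a i : ℂ) + z * (b i : ℂ)) * g (y i)) ∧
      (∀ z g, seqIter (fun i => S.transfer i z) s n g x'
        = ∑ i, Complex.exp ((a' i : ℂ) + z * (b' i : ℂ)) * g (y' i)) ∧
      (∀ i, dist (y i) (y' i) ≤ dist x x' ∧ |b i| ≤ S.birkhoffSup s n ∧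
        |b' i| ≤ S.birkhoffSup s n ∧
        |a i - a' i| ≤ S.birkhoffVar (fun k => holderNorm α (S.φ k)) s n * dist x x' ^ α ∧
        |b i - b' i| ≤ S.birkhoffVar (fun k => holderNorm α (S.f k)) s n * dist x x' ^ α) := by
  induction n with
  | zero =>
    refine ⟨PUnit, inferInstance, fun _ => x, fun _ => x', 0, 0, 0, 0, fun z g => ?_,
      fun z g => ?_, fun _ => ?_⟩
    · simp [seqIter]
    · simp [seqIter]
    · simp [birkhoffSup, birkhoffVar]
  | succ n ih =>
    obtain ⟨e, he⟩ := S.pairing (s + n) x x' hx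
    have hd : ∀ p : ↥(S.T (s + n) ⁻¹' {x}), dist (p : X (s + n)) (e p : X (s + n)) ≤ (S.γ (s + n))⁻¹ * dist x x' :=
      fun p => (he p).trans (min_le_left _ _)
    -- The second bound in the minimum of `pairing` keeps the paired preimages within `ξ (s + n)`,
    -- so the induction hypothesis applies to them.
    choose ι inst y y' a a' b b' h1 h2 h3 using
      fun p : ↥(S.T (s + n) ⁻¹' {x}) => ih p (e p) ((he p).trans (min_le_right _ _))
    have := Fintype.ofFinite ↥(S.T (s + n) ⁻¹' {x})
    have := Fintype.ofFinite ↥(S.T (s + n) ⁻¹' {x'})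
    have hdα : ∀ p : ↥(S.T (s + n) ⁻¹' {x}), dist (p : X (s + n)) (e p : X (s + n)) ^ α
        ≤ S.γ (s + n) ^ (-α) * dist x x' ^ α := by
      intro p
      have hγ := (S.γ_pos (s + n)).le
      rw [Real.rpow_neg hγ, ← Real.inv_rpow hγ, ← Real.mul_rpow (inv_nonneg.2 hγ) dist_nonneg]
      exact Real.rpow_le_rpow dist_nonneg (hd p) S.α_pos.le
    have hvar : ∀ (v : ℕ → ℝ) (_ : ∀ k, 0 ≤ v k) (c c' d d' : ℝ) (p : ↥(S.T (s + n) ⁻¹' {x})),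
        |c - c'| ≤ S.birkhoffVar v s n * dist (p : X (s + n)) (e p : X (s + n)) ^ α →
        |d - d'| ≤ v (s + n) * dist (p : X (s + n)) (e p : X (s + n)) ^ α →
        |(d + c) - (d' + c')| ≤ S.birkhoffVar v s (n + 1) * dist x x' ^ α := by
      intro v hv c c' d d' p hc hd'
      have e1 : (d + c) - (d' + c') = (c - c') + (d - d') := by ring
      have h0 : 0 ≤ S.birkhoffVar v s n + v (s + n) :=
        add_nonneg (S.birkhoffVar_nonneg hv s n) (hv _)
      rw [e1, S.birkhoffVar_succ, mul_assoc]
      refine (abs_add_le _ _).trans ((add_le_add hc hd').trans ?_)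
      rw [← add_mul]
      exact mul_le_mul_of_nonneg_left (hdα p) h0
    refine ⟨Σ p : ↥(S.T (s + n) ⁻¹' {x}), ι p, inferInstance, fun q => y q.1 q.2,
      fun q => y' q.1 q.2, fun q => S.φ (s + n) q.1 + a q.1 q.2,
      fun q => S.φ (s + n) (e q.1) + a' q.1 q.2, fun q => S.f (s + n) q.1 + b q.1 q.2,
      fun q => S.f (s + n) (e q.1) + b' q.1 q.2, fun z g => ?_, fun z g => ?_, fun q => ?_⟩
    · change S.transfer (s + n) z (seqIter (fun i => S.transfer i z) s n g) x = _
      rw [transfer_apply_eq_sum, Fintype.sum_sigma]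
      refine Finset.sum_congr rfl fun p _ => ?_
      rw [h1, Finset.mul_sum]
      refine Finset.sum_congr rfl fun i _ => ?_
      rw [← mul_assoc, ← Complex.exp_add]
      push_cast
      ring_nf
    · change S.transfer (s + n) z (seqIter (fun i => S.transfer i z) s n g) x' = _
      rw [transfer_apply_eq_sum, Fintype.sum_sigma, ← Equiv.sum_comp e]
      refine Finset.sum_congr rfl fun p _ => ?_
      rw [h2, Finset.mul_sum]
      refine Finset.sum_congr rfl fun i _ => ?_
      rw [← mul_assoc, ← Complex.exp_add]
      push_cast
      ring_nf
    · obtain ⟨q1, q2, q3, q4, q5⟩ := h3 q.1 q.2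
      have hsup : ∀ w c, |c| ≤ S.birkhoffSup s n →
          |S.f (s + n) w + c| ≤ S.birkhoffSup s (n + 1) := by
        intro w c hc
        rw [birkhoffSup, Finset.sum_range_succ, add_comm (S.f (s + n) w)]
        exact (abs_add_le _ _).trans (add_le_add hc ((S.isHolder_f (s + n)).norm_le w))
      refine ⟨q1.trans ((hd q.1).trans
          (mul_le_of_le_one_left dist_nonneg (inv_le_one_of_one_le₀ (S.one_le_γ _)))),
        hsup _ _ q2, hsup _ _ q3, ?_, ?_⟩
      · exact hvar _ (fun k => holderNorm_nonneg _ _) _ _ _ _ q.1 q4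
          ((S.isHolder_φ (s + n)).norm_sub_le _ _)
      · exact hvar _ (fun k => holderNorm_nonneg _ _) _ _ _ _ q.1 q5
          ((S.isHolder_f (s + n)).norm_sub_le _ _)

/-- Having both exponentials on the right matters: summed over the branches each family of weights
has mass one, so no bound on the size of the Birkhoff sums of `φ` enters. -/
lemma abs_exp_sub_exp_le (a b : ℝ) :
    |Real.exp a - Real.exp b| ≤ |a - b| * (Real.exp a + Real.exp b) := by
  have key : ∀ a b : ℝ, b ≤ a → Real.exp a - Real.exp b ≤ (a - b) * (Real.exp a + Real.exp b) := by
    intro a b hab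
    have h1 := Real.add_one_le_exp (b - a)
    have h2 : Real.exp b = Real.exp a * Real.exp (b - a) := by rw [← Real.exp_add]; ring_nf
    have h3 := Real.exp_pos a
    have h4 := Real.exp_pos b
    have h5 : Real.exp a * (b - a + 1) ≤ Real.exp b := by
      rw [h2]; exact mul_le_mul_of_nonneg_left h1 h3.le
    nlinarith
  rcases le_total b a with h | h
  · rw [abs_of_nonneg (by linarith [Real.exp_le_exp.2 h]), abs_of_nonneg (by linarith)]
    exact key a b h
  · rw [abs_sub_comm, abs_sub_comm a,
      abs_of_nonneg (by linarith [Real.exp_le_exp.2 h]), abs_of_nonneg (by linarith), add_comm]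
    exact key b a h

/-- The distance between the perturbed and the unperturbed iterates of the transfer operators. -/
lemma norm_seqIter_transfer_sub_le (s n : ℕ) (z : ℂ) {F V W Ξ : ℝ}
    (hF : S.birkhoffSup s n ≤ F)
    (hV : S.birkhoffVar (fun k => holderNorm α (S.φ k)) s n ≤ V)
    (hW : S.birkhoffVar (fun k => holderNorm α (S.f k)) s n ≤ W)
    (hΞ : (S.ξ (s + n))⁻¹ ≤ Ξ) (hz : ‖z‖ * F ≤ 1) :
    ‖seqIter (fun i => S.transfer i z) s n - seqIter (fun i => S.transfer i 0) s n‖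
      ≤ 2 * (‖z‖ * F) + max (4 * (‖z‖ * F) * Ξ)
          (‖z‖ * (4 * (F * V) + 3 * W + 2 * F)) := by
  have hF0 : 0 ≤ F := (S.birkhoffSup_nonneg s n).trans hF
  have hV0 : 0 ≤ V := (S.birkhoffVar_nonneg (fun k => holderNorm_nonneg _ _) s n).trans hV
  have hW0 : 0 ≤ W := (S.birkhoffVar_nonneg (fun k => holderNorm_nonneg _ _) s n).trans hW
  have hξ0 := S.ξ_pos (s + n)
  have hΞ1 : 1 ≤ Ξ := ((one_le_inv₀ hξ0).2 (S.ξ_le_one _)).trans hΞ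
  set t := ‖z‖ with ht
  have ht0 : 0 ≤ t := norm_nonneg z
  set Y := max (4 * (t * F) * Ξ) (t * (4 * (F * V) + 3 * W + 2 * F)) with hY
  have hY0 : 0 ≤ Y := le_max_of_le_left (by positivity)
  refine ContinuousLinearMap.opNorm_le_bound _ (by positivity) fun g => ?_
  set G := ‖g‖ with hG
  have hG0 : 0 ≤ G := norm_nonneg g
  have hw1 : ∀ b : ℝ, |b| ≤ S.birkhoffSup s n → ‖z * b‖ ≤ t * F := fun b hb => by
    rw [norm_mul, Complex.norm_real]
    exact mul_le_mul_of_nonneg_left (hb.trans hF) ht0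
  have hw : ∀ b : ℝ, |b| ≤ S.birkhoffSup s n → ‖Complex.exp (z * b) - 1‖ ≤ 2 * (t * F) := by
    intro b hb
    have h := hw1 b hb
    exact (Complex.norm_exp_sub_one_le (h.trans hz)).trans (by linarith)
  -- The weights sum to one: take `z = 0` and the constant function `1`, which the unperturbed
  -- iterates preserve.
  have hsum : ∀ {ι : Type u} [Fintype ι] (y : ι → X s) (a b : ι → ℝ) (x : X (s + n)),
      (∀ z g, seqIter (fun i => S.transfer i z) s n g x
        = ∑ i, Complex.exp ((a i : ℂ) + z * (b i : ℂ)) * g (y i)) →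
      (∑ i, Real.exp (a i) = 1) ∧
        (seqIter (fun i => S.transfer i z) s n - seqIter (fun i => S.transfer i 0) s n) g x
          = ∑ i, (Real.exp (a i) : ℂ) * ((Complex.exp (z * b i) - 1) * g (y i)) := by
    intro ι _ y a b x h
    refine ⟨?_, ?_⟩
    · have h1 := h 0 HolderSpace.one
      rw [S.seqIter_transfer_one] at h1
      simp only [HolderSpace.one_apply, zero_mul, add_zero, mul_one] at h1
      exact_mod_cast h1.symm
    · change seqIter (fun i => S.transfer i z) s n g x - seqIter (fun i => S.transfer i 0) s n g x
        = _
      rw [h, h, ← Finset.sum_sub_distrib]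
      refine Finset.sum_congr rfl fun i _ => ?_
      rw [Complex.exp_add, zero_mul, add_zero, Complex.ofReal_exp]
      ring
  have hsup : ∀ x, ‖(seqIter (fun i => S.transfer i z) s n
      - seqIter (fun i => S.transfer i 0) s n) g x‖ ≤ 2 * (t * F) * G := by
    intro x
    -- Pairing `x` with itself yields the branch formula at a single point.
    obtain ⟨ι, _, y, y', a, a', b, b', h1, h2, h3⟩ := S.exists_paired_preimages s n x x
      (by rw [dist_self]; exact hξ0.le)
    obtain ⟨hs, he⟩ := hsum y a b x h1
    rw [he]
    calc _ ≤ ∑ i, Real.exp (a i) * (2 * (t * F) * G) := by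
          refine norm_sum_le_of_le _ fun i _ => ?_
          rw [norm_mul, norm_mul, Complex.norm_real, Real.norm_of_nonneg (Real.exp_pos _).le]
          exact mul_le_mul_of_nonneg_left (mul_le_mul (hw _ (h3 i).2.1) (g.isHolder.norm_le _)
            (norm_nonneg _) (by positivity)) (Real.exp_pos _).le
      _ = _ := by rw [← Finset.sum_mul, hs, one_mul]
  rw [add_mul]
  refine holderNorm_le_add (by positivity) (by positivity) hsup fun x x' => ?_
  have hdα := Real.rpow_nonneg (dist_nonneg (x := x) (y := x')) α
  set d := dist x x' ^ α
  by_cases hx : dist x x' ≤ S.ξ (s + n)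
  · obtain ⟨ι, _, y, y', a, a', b, b', h1, h2, h3⟩ := S.exists_paired_preimages s n x x' hx
    obtain ⟨hs, he⟩ := hsum y a b x h1
    obtain ⟨hs', he'⟩ := hsum y' a' b' x' h2
    rw [he, he', ← Finset.sum_sub_distrib]
    -- Three variations are separated: of the weight, of the factor `exp (z b)`, and of `g`. After
    -- summation they produce `4 * (F * V)`, `3 * W` (from `e < 3`) and `2 * F`.
    have hterm : ∀ i, ‖(Real.exp (a i) : ℂ) * ((Complex.exp (z * b i) - 1) * g (y i))
        - (Real.exp (a' i) : ℂ) * ((Complex.exp (z * b' i) - 1) * g (y' i))‖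
        ≤ (Real.exp (a i) + Real.exp (a' i)) * (V * d * (2 * (t * F) * G))
          + Real.exp (a' i) * ((3 * (t * (W * d))) * G + 2 * (t * F) * (G * d)) := by
      intro i
      obtain ⟨q1, q2, q3, q4, q5⟩ := h3 i
      have e1 : (Real.exp (a i) : ℂ) * ((Complex.exp (z * b i) - 1) * g (y i))
          - (Real.exp (a' i) : ℂ) * ((Complex.exp (z * b' i) - 1) * g (y' i))
          = ((Real.exp (a i) - Real.exp (a' i) : ℝ) : ℂ) * ((Complex.exp (z * b i) - 1) * g (y i))
          + (Real.exp (a' i) : ℂ) * ((Complex.exp (z * b i) - Complex.exp (z * b' i)) * g (y i)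
            + (Complex.exp (z * b' i) - 1) * (g (y i) - g (y' i))) := by
        push_cast
        ring
      rw [e1]
      refine (norm_add_le _ _).trans (add_le_add ?_ ?_)
      · rw [norm_mul, norm_mul, Complex.norm_real, Real.norm_eq_abs]
        have p1 : |Real.exp (a i) - Real.exp (a' i)|
            ≤ (V * d) * (Real.exp (a i) + Real.exp (a' i)) :=
          (abs_exp_sub_exp_le _ _).trans (mul_le_mul_of_nonneg_right
            (q4.trans (mul_le_mul_of_nonneg_right hV hdα)) (by positivity))
        have p2 : ‖Complex.exp (z * b i) - 1‖ * ‖g (y i)‖ ≤ 2 * (t * F) * G :=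
          mul_le_mul (hw _ q2) (g.isHolder.norm_le _) (norm_nonneg _) (by positivity)
        calc _ ≤ (V * d) * (Real.exp (a i) + Real.exp (a' i)) * (2 * (t * F) * G) :=
              mul_le_mul p1 p2 (by positivity) (by positivity)
          _ = _ := by ring
      · rw [norm_mul, Complex.norm_real, Real.norm_of_nonneg (Real.exp_pos _).le]
        refine mul_le_mul_of_nonneg_left ((norm_add_le _ _).trans (add_le_add ?_ ?_))
          (Real.exp_pos _).le
        · rw [norm_mul]
          refine mul_le_mul ?_ (g.isHolder.norm_le _) (norm_nonneg _) (by positivity)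
          refine (norm_exp_sub_exp_le ((hw1 _ q2).trans hz) ((hw1 _ q3).trans hz)).trans ?_
          rw [← mul_sub, norm_mul, ← Complex.ofReal_sub, Complex.norm_real]
          refine mul_le_mul (by linarith [Real.exp_one_lt_d9]) ?_ (by positivity) (by norm_num)
          exact mul_le_mul_of_nonneg_left (q5.trans (mul_le_mul_of_nonneg_right hW hdα)) ht0
        · rw [norm_mul]
          refine mul_le_mul (hw _ q3) ((g.isHolder.norm_sub_le _ _).trans ?_) (norm_nonneg _)
            (by positivity)
          exact mul_le_mul_of_nonneg_left (Real.rpow_le_rpow dist_nonneg q1 S.α_pos.le) hG0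
    calc _ ≤ ∑ i, ((Real.exp (a i) + Real.exp (a' i)) * (V * d * (2 * (t * F) * G))
          + Real.exp (a' i) * ((3 * (t * (W * d))) * G + 2 * (t * F) * (G * d))) :=
          norm_sum_le_of_le _ fun i _ => hterm i
      _ = (t * (4 * (F * V) + 3 * W + 2 * F)) * G * d := by
          rw [Finset.sum_add_distrib, ← Finset.sum_mul, ← Finset.sum_mul, Finset.sum_add_distrib,
            hs, hs']
          ring
      _ ≤ Y * G * d := by
          have := le_max_right (4 * (t * F) * Ξ) (t * (4 * (F * V) + 3 * W + 2 * F))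
          gcongr
  · have hd1 : 1 ≤ Ξ * d := by
      have h1 : S.ξ (s + n) ≤ d := by
        have h2 : S.ξ (s + n) ^ α ≤ d :=
          Real.rpow_le_rpow hξ0.le (not_le.1 hx).le S.α_pos.le
        refine le_trans ?_ h2
        conv_lhs => rw [← Real.rpow_one (S.ξ (s + n))]
        exact Real.rpow_le_rpow_of_exponent_ge hξ0 (S.ξ_le_one _) S.α_le_one
      calc (1 : ℝ) = (S.ξ (s + n))⁻¹ * S.ξ (s + n) := (inv_mul_cancel₀ hξ0.ne').symm
        _ ≤ Ξ * d := mul_le_mul hΞ h1 hξ0.le (by linarith)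
    calc _ ≤ 2 * (t * F) * G + 2 * (t * F) * G :=
          (norm_sub_le _ _).trans (add_le_add (hsup x) (hsup x'))
      _ = 4 * (t * F) * G * 1 := by ring
      _ ≤ 4 * (t * F) * G * (Ξ * d) := mul_le_mul_of_nonneg_left hd1 (by positivity)
      _ = 4 * (t * F) * Ξ * G * d := by ring
      _ ≤ Y * G * d := by
          have := le_max_left (4 * (t * F) * Ξ) (t * (4 * (F * V) + 3 * W + 2 * F))
          gcongr

end ExpandingSequence

/-! ### Growth of the block endpoints and positivity of the constants -/

namespace Constants

variable (P : Constants) {ε₀ : ℝ}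

lemma ε_pos : 0 < P.ε := mul_pos P.εbar_pos (by linarith [P.η₀_nonneg])

lemma β_pos : 0 < P.β := P.ε_pos.trans P.lt_β

lemma sub_pos : 0 < P.β - P.ε := _root_.sub_pos.2 P.lt_β

lemma one_le_C₁ : 1 ≤ P.C₁ := le_max_left _ _

lemma one_le_blockScale (hε₀ : 0 < ε₀) : 1 ≤ P.blockScale ε₀ := by
  refine Real.one_le_rpow ?_ (one_div_nonneg.2 P.β_pos.le)
  have : 0 < 2 / ε₀ := by positivity
  nlinarith [P.one_le_C₁]

lemma blockScale_rpow (hε₀ : 0 < ε₀) : P.blockScale ε₀ ^ P.β = (2 / ε₀ + 1) * P.C₁ := by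
  have := P.one_le_C₁
  rw [blockScale, ← Real.rpow_mul (by positivity), one_div_mul_cancel P.β_pos.ne', Real.rpow_one]

lemma one_le_C₄ (hε₀ : 0 < ε₀) : 1 ≤ P.C₄ ε₀ := by
  have := P.one_le_blockScale hε₀
  rw [C₄]
  linarith

/-- The exponent `β / (β - ε)` with which `N_j` grows. -/
def growth : ℝ := P.β / (P.β - P.ε)

/-- The fixed-point relation behind the exponent: if `N_j` is of order `j ^ p`, then increments of
order `N_j ^ (ε / β)` must have order `j ^ (p - 1)`. -/
lemma growth_mul : P.growth * (P.ε / P.β) = P.growth - 1 := by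
  have := P.β_pos.ne'
  have := P.sub_pos.ne'
  unfold growth
  field_simp
  ring

lemma one_le_growth : 1 ≤ P.growth := by
  rw [growth, one_le_div P.sub_pos]
  linarith [P.ε_pos]

lemma one_le_A₂ (hε₀ : 0 < ε₀) : 1 ≤ P.A₂ ε₀ :=
  Real.one_le_rpow (P.one_le_C₄ hε₀) (zero_le_one.trans P.one_le_growth)

lemma A₂'_eq (hε₀ : 0 < ε₀) : P.A₂' ε₀ = P.A₂ ε₀ := by
  have h := P.one_le_C₄ hε₀
  have h1 : P.A₂ ε₀ = P.C₄ ε₀ ^ P.growth := rfl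
  rw [A₂', h1, ← Real.rpow_mul (by linarith), growth_mul]
  nth_rewrite 1 [← Real.rpow_one (P.C₄ ε₀)]
  rw [← Real.rpow_add (by linarith)]
  ring_nf

lemma C₄_le_A₂ (hε₀ : 0 < ε₀) : P.C₄ ε₀ ≤ P.A₂ ε₀ := by
  nth_rewrite 1 [← Real.rpow_one (P.C₄ ε₀)]
  exact Real.rpow_le_rpow_of_exponent_le (P.one_le_C₄ hε₀) P.one_le_growth

lemma one_le_N_succ (hε₀ : 0 < ε₀) (j : ℕ) : 1 ≤ P.N ε₀ (j + 1) := by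
  induction j with
  | zero =>
    rw [N, Nat.one_le_ceil_iff]
    linarith [P.one_le_blockScale hε₀]
  | succ j ih => exact ih.trans (P.N_le_succ ε₀ (j + 1))

/-- Replacing `N_j` by `max N_j 1` merges the initial step with the recursion, since `N_0 = 0`. -/
lemma N_succ_eq (hε₀ : 0 < ε₀) (j : ℕ) : P.N ε₀ (j + 1)
    = P.N ε₀ j + ⌈P.blockScale ε₀ * (max (P.N ε₀ j : ℝ) 1) ^ (P.ε / P.β)⌉₊ := by
  cases j with
  | zero => simp [N]
  | succ j =>
    have h : (1 : ℝ) ≤ P.N ε₀ (j + 1) := by exact_mod_cast P.one_le_N_succ hε₀ j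
    rw [max_eq_left h, N]

lemma le_N_sub (hε₀ : 0 < ε₀) (j : ℕ) :
    P.blockScale ε₀ * (max (P.N ε₀ j : ℝ) 1) ^ (P.ε / P.β)
      ≤ ((P.N ε₀ (j + 1) - P.N ε₀ j : ℕ) : ℝ) := by
  rw [N_succ_eq P hε₀ j, Nat.add_sub_cancel_left]
  exact Nat.le_ceil _

/-- The power is at least one, so the error of the ceiling is absorbed by the summand `1` in `C₄`.
-/
lemma N_sub_le (hε₀ : 0 < ε₀) (j : ℕ) :
    (P.N ε₀ (j + 1) : ℝ) - P.N ε₀ j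
      ≤ P.C₄ ε₀ * (max (P.N ε₀ j : ℝ) 1) ^ (P.ε / P.β) := by
  have h1 : 1 ≤ (max (P.N ε₀ j : ℝ) 1) ^ (P.ε / P.β) :=
    Real.one_le_rpow (le_max_right _ _) (div_nonneg P.ε_pos.le P.β_pos.le)
  have h2 := P.one_le_blockScale hε₀
  rw [N_succ_eq P hε₀ j, Nat.cast_add, add_sub_cancel_left, C₄, add_mul, one_mul]
  exact (Nat.ceil_lt_add_one (by positivity)).le.trans (by linarith)

/-- By `A₂'_eq` the increment is at most `A₂ * j ^ (p - 1)` with `p` the growth exponent. The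
induction closes with the same constant because `j ^ p + j ^ (p - 1) = j ^ (p - 1) * (j + 1) ≤ (j +
1) ^ p`. -/
lemma N_le (hε₀ : 0 < ε₀) (j : ℕ) : (P.N ε₀ j : ℝ) ≤ P.A₂ ε₀ * (j : ℝ) ^ P.growth := by
  have hg := P.one_le_growth
  have hA := P.one_le_A₂ hε₀
  induction j with
  | zero => simp [N, Real.zero_rpow (by linarith : P.growth ≠ 0)]
  | succ j ih =>
    have h := P.N_sub_le hε₀ j
    rcases Nat.eq_zero_or_pos j with rfl | hj
    · have h0 := P.C₄_le_A₂ hε₀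
      simp only [N, CharP.cast_eq_zero, sub_zero, zero_le_one, sup_of_le_right, Real.one_rpow,
        mul_one, zero_add, Nat.cast_one] at h ⊢
      exact h.trans h0
    · have hN : (1 : ℝ) ≤ P.N ε₀ j := by
        obtain ⟨i, rfl⟩ := Nat.exists_eq_succ_of_ne_zero hj.ne'
        exact_mod_cast P.one_le_N_succ hε₀ i
      have hj' : (0 : ℝ) < j := by exact_mod_cast hj
      rw [max_eq_left hN] at h
      have h1 : (P.N ε₀ j : ℝ) ^ (P.ε / P.β)
          ≤ P.A₂ ε₀ ^ (P.ε / P.β) * (j : ℝ) ^ (P.growth - 1) := by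
        rw [← growth_mul, Real.rpow_mul hj'.le, ← Real.mul_rpow (by linarith) (by positivity)]
        exact Real.rpow_le_rpow (by linarith) ih (div_nonneg P.ε_pos.le P.β_pos.le)
      have h2 : P.C₄ ε₀ * (P.N ε₀ j : ℝ) ^ (P.ε / P.β)
          ≤ P.A₂ ε₀ * (j : ℝ) ^ (P.growth - 1) := by
        rw [← P.A₂'_eq hε₀]
        rw [A₂', mul_assoc]
        exact mul_le_mul_of_nonneg_left h1 (by linarith [P.one_le_C₄ hε₀])
      have h3 : (j : ℝ) ^ P.growth = (j : ℝ) ^ (P.growth - 1) * j := by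
        rw [← Real.rpow_add_one hj'.ne', sub_add_cancel]
      have h4 : ((j : ℝ) + 1) ^ P.growth = ((j : ℝ) + 1) ^ (P.growth - 1) * (j + 1) := by
        rw [← Real.rpow_add_one (by positivity), sub_add_cancel]
      have h5 : (j : ℝ) ^ (P.growth - 1) ≤ ((j : ℝ) + 1) ^ (P.growth - 1) :=
        Real.rpow_le_rpow hj'.le (by linarith) (by linarith)
      push_cast
      rw [h4]
      calc (P.N ε₀ (j + 1) : ℝ)
          ≤ P.A₂ ε₀ * (j : ℝ) ^ P.growth + P.A₂ ε₀ * (j : ℝ) ^ (P.growth - 1) := by linarith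
        _ = P.A₂ ε₀ * ((j : ℝ) ^ (P.growth - 1) * (j + 1)) := by rw [h3]; ring
        _ ≤ _ := by gcongr

lemma max_N_le (hε₀ : 0 < ε₀) (j : ℕ) :
    max (P.N ε₀ j : ℝ) 1 ≤ P.A₂ ε₀ * ((j : ℝ) + 1) ^ P.growth := by
  have hg := P.one_le_growth
  have hA := P.one_le_A₂ hε₀
  refine max_le ((P.N_le hε₀ j).trans ?_) ?_
  · gcongr
    linarith
  · have : 1 ≤ ((j : ℝ) + 1) ^ P.growth :=
      Real.one_le_rpow (by linarith [j.cast_nonneg (α := ℝ)]) (by linarith)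
    nlinarith

lemma N_sub_le' (hε₀ : 0 < ε₀) (j : ℕ) :
    (P.N ε₀ (j + 1) : ℝ) - P.N ε₀ j ≤ P.A₂' ε₀ * ((j : ℝ) + 1) ^ (P.growth - 1) := by
  have hA := P.one_le_A₂ hε₀
  refine (P.N_sub_le hε₀ j).trans ?_
  rw [A₂', mul_assoc]
  refine mul_le_mul_of_nonneg_left ?_ (by linarith [P.one_le_C₄ hε₀])
  rw [← growth_mul, Real.rpow_mul (by positivity), ← Real.mul_rpow (by linarith) (by positivity)]
  exact Real.rpow_le_rpow (by positivity) (P.max_N_le hε₀ j) (div_nonneg P.ε_pos.le P.β_pos.le)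

lemma summable_C' : Summable fun d : ℕ => ((d : ℝ) + 1) ^ (-P.a₀) := by
  have h := (summable_nat_add_iff 1).2 (Real.summable_nat_rpow.2 (neg_lt_neg P.one_lt_a₀))
  simpa using h

lemma C'_nonneg : 0 ≤ P.C' := tsum_nonneg fun _ => by positivity

lemma sum_le_C' (n : ℕ) :
    ∑ k ∈ Finset.range n, ((n - k : ℕ) : ℝ) ^ (-P.a₀) ≤ P.C' := by
  have h := P.summable_C'.sum_le_tsum (Finset.range n) (fun _ _ => by positivity)
  rw [← Finset.sum_range_reflect] at h
  refine le_trans (le_of_eq (Finset.sum_congr rfl fun k hk => ?_)) h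
  have hk' := Finset.mem_range.1 hk
  have : n - k = (n - 1 - k) + 1 := by omega
  rw [this, Nat.cast_add_one]

lemma A₂_pos (hε₀ : 0 < ε₀) : 0 < P.A₂ ε₀ := zero_lt_one.trans_le (P.one_le_A₂ hε₀)

lemma Q₃_pos (hε₀ : 0 < ε₀) : 0 < P.Q₃ ε₀ := by
  have := P.A₂_pos hε₀
  have := P.E₂_pos
  rw [Q₃, P.A₂'_eq hε₀]
  have : 0 < max P.E₂ P.E₃ := lt_max_of_lt_left P.E₂_pos
  positivity

lemma E₅_pos (hε₀ : 0 < ε₀) : 0 < P.E₅ ε₀ := by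
  have := P.A₂_pos hε₀
  have := P.E₂_pos
  have := P.E₄_pos
  have := P.Q₃_pos hε₀
  rw [E₅]
  positivity

lemma E₇_pos (hε₀ : 0 < ε₀) : 0 < P.E₇ ε₀ := by
  have := P.A₂_pos hε₀
  have := P.E₂_pos
  have := P.E₄_pos
  have := P.E₆_pos
  rw [E₇]
  positivity

lemma E₉_pos (hε₀ : 0 < ε₀) : 0 < P.E₉ ε₀ := by
  have := P.A₂_pos hε₀
  have := P.E₂_pos
  have := P.E₈_pos
  have := P.E₅_pos hε₀
  have := P.E₇_pos hε₀
  have := P.C'_nonneg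
  rw [E₉]
  positivity

end Constants

/-! ### Estimates over one block -/

namespace ExpandingSequence

variable {X : ℕ → Type*} [∀ j, MetricSpace (X j)] [∀ j, MeasurableSpace (X j)]
  [∀ j, BorelSpace (X j)] {α : ℝ} {S : ExpandingSequence X α}

namespace Standing

variable {P : Constants} {R : ℕ → ℝ} {m : ℕ → ℕ} {ε₀ : ℝ}

lemma R_le (H : S.Standing P R m) {k : ℕ} (hk : 1 ≤ k) : R (m k) ≤ P.D := by
  have h : m k ∈ {k : ℕ | 1 ≤ k ∧ R k ≤ P.D} := by
    rw [H.good_times]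
    exact ⟨k, hk, rfl⟩
  exact h.2

lemma le_m (H : S.Standing P R m) (k : ℕ) : k ≤ m k := H.m_strictMono.le_apply

lemma one_le_E₂ (H : S.Standing P R m) : 1 ≤ P.E₂ := by
  have h := H.m_le 1 le_rfl
  have h1 : (1 : ℝ) ≤ m 1 := by exact_mod_cast H.le_m 1
  simp only [Nat.cast_one, Real.one_rpow, mul_one] at h
  linarith

lemma one_le_E₈ (H : S.Standing P R m) : 1 ≤ P.E₈ := by
  have h := H.ξ_inv_le 1 le_rfl
  have h1 := (one_le_inv₀ (S.ξ_pos 1)).2 (S.ξ_le_one 1)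
  simp only [Nat.cast_one, Real.one_rpow, mul_one] at h
  linarith

/-- Good times are distinct integers, so a block of indices is no longer than the corresponding
block of times. This transfers lower bounds on `N_{j+1} - N_j` to the number of iterations. -/
lemma sub_le_sub (H : S.Standing P R m) {i j : ℕ} (h : i ≤ j) : j - i ≤ m j - m i := by
  have key : j + m i ≤ m j + i := by
    induction j, h using Nat.le_induction with
    | base => omega
    | succ j _ ih =>
      have := H.m_strictMono (Nat.lt_succ_self j)
      simp only [Nat.succ_eq_add_one] at this
      omega
  omega

lemma ell_eq (H : S.Standing P R m) (j : ℕ) : P.ell ε₀ m j = m (P.N ε₀ j) :=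
  P.ell_eq ε₀ H.m_strictMono.monotone j

lemma m_sub_le (H : S.Standing P R m) {i j : ℕ} (h : i ≤ j) :
    (m j : ℝ) - m i ≤ ((j : ℝ) - i) * (max P.E₂ P.E₃ * (j : ℝ) ^ P.δ) := by
  have hM : 0 < max P.E₂ P.E₃ := lt_max_of_lt_left P.E₂_pos
  induction j, h using Nat.le_induction with
  | base => simp
  | succ j hij ih =>
    -- The gap from `m 0 = 0` to `m 1` is outside `gap_le` and is bounded by `E₂`; hence the maximum
    -- of `E₂` and `E₃`.
    have h1 : (m (j + 1) : ℝ) - m j ≤ max P.E₂ P.E₃ * ((j : ℝ) + 1) ^ P.δ := by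
      rcases Nat.eq_zero_or_pos j with rfl | hj
      · have h2 := H.m_le 1 le_rfl
        simp only [Nat.cast_one, Real.one_rpow, mul_one] at h2
        simpa [H.m_zero] using h2.trans (le_max_left _ P.E₃)
      · refine (H.gap_le j hj).trans ?_
        refine mul_le_mul (le_max_right _ _) ?_ (by positivity) hM.le
        exact Real.rpow_le_rpow (by positivity) (by linarith) P.δ_nonneg
    have h3 : (j : ℝ) ^ P.δ ≤ ((j : ℝ) + 1) ^ P.δ :=
      Real.rpow_le_rpow (by positivity) (by linarith) P.δ_nonneg
    have hij' : (0 : ℝ) ≤ (j : ℝ) - i := by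
      have : (i : ℝ) ≤ j := by exact_mod_cast hij
      linarith
    have h4 : ((j : ℝ) - i) * (max P.E₂ P.E₃ * (j : ℝ) ^ P.δ)
        ≤ ((j : ℝ) - i) * (max P.E₂ P.E₃ * ((j : ℝ) + 1) ^ P.δ) := by gcongr
    push_cast
    linarith

/-- The length of a block. -/
lemma length_le (H : S.Standing P R m) (hε₀ : 0 < ε₀) (j : ℕ) :
    ((m (P.N ε₀ (j + 1)) - m (P.N ε₀ j) : ℕ) : ℝ)
      ≤ P.Q₃ ε₀ * ((j : ℝ) + 1) ^ (P.growth - 1 + P.growth * P.δ) := by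
  have hA := P.A₂_pos hε₀
  have hM : 0 < max P.E₂ P.E₃ := lt_max_of_lt_left P.E₂_pos
  have hA' : 0 < P.A₂' ε₀ := by rw [P.A₂'_eq hε₀]; exact hA
  have hle := P.N_le_succ ε₀ j
  have hq : (0 : ℝ) < (j : ℝ) + 1 := by positivity
  rw [Nat.cast_sub (H.m_strictMono.monotone hle)]
  refine (H.m_sub_le hle).trans ?_
  have h1 : (P.N ε₀ (j + 1) : ℝ) ^ P.δ
      ≤ P.A₂ ε₀ ^ P.δ * ((j : ℝ) + 1) ^ (P.growth * P.δ) := by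
    rw [Real.rpow_mul hq.le, ← Real.mul_rpow hA.le (by positivity)]
    have := P.N_le hε₀ (j + 1)
    push_cast at this
    exact Real.rpow_le_rpow (by positivity) this P.δ_nonneg
  -- The power of two in `Q₃` enters only through being at least one.
  have h2 : (1 : ℝ) ≤ 2 ^ ((P.ε + P.δ * P.β) / (P.β - P.ε)) :=
    Real.one_le_rpow one_le_two (div_nonneg (add_nonneg P.ε_pos.le
      (mul_nonneg P.δ_nonneg P.β_pos.le)) P.sub_pos.le)
  calc ((P.N ε₀ (j + 1) : ℝ) - P.N ε₀ j) * (max P.E₂ P.E₃ * (P.N ε₀ (j + 1) : ℝ) ^ P.δ)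
      ≤ (P.A₂' ε₀ * ((j : ℝ) + 1) ^ (P.growth - 1)) *
        (max P.E₂ P.E₃ * (P.A₂ ε₀ ^ P.δ * ((j : ℝ) + 1) ^ (P.growth * P.δ))) := by
        have := P.N_sub_le' hε₀ j
        gcongr
    _ = 1 * (max P.E₂ P.E₃ * P.A₂' ε₀ * P.A₂ ε₀ ^ P.δ *
        (((j : ℝ) + 1) ^ (P.growth - 1) * ((j : ℝ) + 1) ^ (P.growth * P.δ))) := by ring
    _ ≤ 2 ^ ((P.ε + P.δ * P.β) / (P.β - P.ε)) * (max P.E₂ P.E₃ * P.A₂' ε₀ * P.A₂ ε₀ ^ P.δ *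
        (((j : ℝ) + 1) ^ (P.growth - 1) * ((j : ℝ) + 1) ^ (P.growth * P.δ))) := by gcongr
    _ = _ := by rw [← Real.rpow_add hq, Constants.Q₃]; ring

/-- Powers of the right endpoint of a block. -/
lemma end_rpow_le (H : S.Standing P R m) (hε₀ : 0 < ε₀) (j : ℕ) {b : ℝ} (hb : 0 ≤ b) :
    (m (P.N ε₀ (j + 1)) : ℝ) ^ b
      ≤ P.E₂ ^ b * P.A₂ ε₀ ^ (b * (1 + P.η₀)) *
        ((j : ℝ) + 1) ^ (b * (P.growth * (1 + P.η₀))) := by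
  have hA := P.A₂_pos hε₀
  have hη : 0 ≤ 1 + P.η₀ := by linarith [P.η₀_nonneg]
  have hq : (0 : ℝ) < (j : ℝ) + 1 := by positivity
  have h1 := H.m_le _ (P.one_le_N_succ hε₀ j)
  have h2 : (P.N ε₀ (j + 1) : ℝ) ^ (1 + P.η₀)
      ≤ P.A₂ ε₀ ^ (1 + P.η₀) * ((j : ℝ) + 1) ^ (P.growth * (1 + P.η₀)) := by
    rw [Real.rpow_mul hq.le, ← Real.mul_rpow hA.le (by positivity)]
    have := P.N_le hε₀ (j + 1)
    push_cast at this
    exact Real.rpow_le_rpow (by positivity) this hη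
  have h3 := Real.rpow_le_rpow (by positivity)
    (h1.trans (mul_le_mul_of_nonneg_left h2 P.E₂_pos.le)) hb
  refine h3.trans (le_of_eq ?_)
  rw [Real.mul_rpow P.E₂_pos.le (by positivity), Real.mul_rpow (by positivity) (by positivity),
    ← Real.rpow_mul hA.le, ← Real.rpow_mul hq.le]
  ring_nf

lemma ell_add (H : S.Standing P R m) (j : ℕ) :
    P.ell ε₀ m j + (m (P.N ε₀ (j + 1)) - m (P.N ε₀ j)) = m (P.N ε₀ (j + 1)) := by
  rw [H.ell_eq]
  have := H.m_strictMono.monotone (P.N_le_succ ε₀ j)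
  omega

lemma max_le_end (H : S.Standing P R m) (hε₀ : 0 < ε₀) (j : ℕ) {k : ℕ}
    (hk : k < m (P.N ε₀ (j + 1)) - m (P.N ε₀ j)) :
    max ((P.ell ε₀ m j + k : ℕ) : ℝ) 1 ≤ (m (P.N ε₀ (j + 1)) : ℝ) := by
  have h1 := H.ell_add (ε₀ := ε₀) j
  have h2 := (P.one_le_N_succ hε₀ j).trans (H.le_m _)
  refine max_le ?_ (by exact_mod_cast h2)
  exact_mod_cast (by omega : P.ell ε₀ m j + k ≤ m (P.N ε₀ (j + 1)))

lemma ζ₁_eq : P.growth - 1 + P.growth * P.δ + P.a * (P.growth * (1 + P.η₀)) = P.ζ₁ := by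
  have := P.sub_pos.ne'
  unfold Constants.growth Constants.ζ₁
  field_simp
  ring

lemma birkhoffSup_le (H : S.Standing P R m) (hε₀ : 0 < ε₀) (j : ℕ) :
    S.birkhoffSup (P.ell ε₀ m j) (m (P.N ε₀ (j + 1)) - m (P.N ε₀ j))
      ≤ P.E₅ ε₀ * ((j : ℝ) + 1) ^ P.ζ₁ := by
  have hq : (0 : ℝ) < (j : ℝ) + 1 := by positivity
  have hE := P.E₄_pos
  set L : ℝ := (m (P.N ε₀ (j + 1)) : ℝ) with hL
  have h1 : S.birkhoffSup (P.ell ε₀ m j) (m (P.N ε₀ (j + 1)) - m (P.N ε₀ j))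
      ≤ ((m (P.N ε₀ (j + 1)) - m (P.N ε₀ j) : ℕ) : ℝ) * (P.E₄ * L ^ P.a) := by
    rw [birkhoffSup]
    refine (Finset.sum_le_card_nsmul _ _ (P.E₄ * L ^ P.a) fun k hk => ?_).trans_eq
      (by rw [Finset.card_range, nsmul_eq_mul])
    refine (H.f_le _).trans (mul_le_mul_of_nonneg_left ?_ hE.le)
    exact Real.rpow_le_rpow (by positivity) (H.max_le_end hε₀ j (Finset.mem_range.1 hk)) P.a_nonneg
  have h2 := H.length_le hε₀ j
  have h3 := H.end_rpow_le hε₀ j P.a_nonneg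
  have hQ := P.Q₃_pos hε₀
  calc _ ≤ _ := h1
    _ ≤ (P.Q₃ ε₀ * ((j : ℝ) + 1) ^ (P.growth - 1 + P.growth * P.δ)) * (P.E₄ *
        (P.E₂ ^ P.a * P.A₂ ε₀ ^ (P.a * (1 + P.η₀)) *
          ((j : ℝ) + 1) ^ (P.a * (P.growth * (1 + P.η₀))))) := by gcongr
    _ = P.E₅ ε₀ * (((j : ℝ) + 1) ^ (P.growth - 1 + P.growth * P.δ) *
          ((j : ℝ) + 1) ^ (P.a * (P.growth * (1 + P.η₀)))) := by rw [Constants.E₅]; ring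
    _ = _ := by rw [← Real.rpow_add hq, ζ₁_eq]

/-- The contraction from position `k` to the end of the block gives `(n - k) ^ (-a₀)`, which is
summable as `a₀ > 1`. Thus the block length does not enter, unlike in `birkhoffSup_le`. -/
lemma birkhoffVar_le (H : S.Standing P R m) (hε₀ : 0 < ε₀) (j : ℕ) {v : ℕ → ℝ}
    (hv : ∀ k : ℕ, v k ≤ P.E₄ * (max (k : ℝ) 1) ^ P.a) :
    S.birkhoffVar v (P.ell ε₀ m j) (m (P.N ε₀ (j + 1)) - m (P.N ε₀ j))
      ≤ P.C' * P.E₇ ε₀ * ((j : ℝ) + 1) ^ ((P.κ + P.a) * (P.growth * (1 + P.η₀))) := by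
  have hE := P.E₄_pos
  have hE6 := P.E₆_pos
  set L : ℝ := (m (P.N ε₀ (j + 1)) : ℝ) with hL
  set n := m (P.N ε₀ (j + 1)) - m (P.N ε₀ j) with hn
  set s := P.ell ε₀ m j with hs
  have hL1 : 1 ≤ L := by
    have := (P.one_le_N_succ hε₀ j).trans (H.le_m _)
    rw [hL]
    exact_mod_cast this
  have hC := P.C'_nonneg
  have hterm : ∀ k ∈ Finset.range n, v (s + k) * ∏ i ∈ Finset.Ico k n, S.γ (s + i) ^ (-α)
      ≤ P.E₄ * P.E₆ * L ^ (P.κ + P.a) * ((n - k : ℕ) : ℝ) ^ (-P.a₀) := by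
    intro k hk
    have hk' := Finset.mem_range.1 hk
    have h1 : v (s + k) ≤ P.E₄ * L ^ P.a :=
      (hv _).trans (mul_le_mul_of_nonneg_left
        (Real.rpow_le_rpow (by positivity) (H.max_le_end hε₀ j hk') P.a_nonneg) hE.le)
    have h2 : ∏ i ∈ Finset.Ico k n, S.γ (s + i) ^ (-α)
        ≤ P.E₆ * L ^ P.κ * ((n - k : ℕ) : ℝ) ^ (-P.a₀) := by
      rw [Finset.prod_Ico_eq_prod_range]
      simp only [← add_assoc]
      refine (H.γ_decay (s + k) (n - k) (by omega)).trans ?_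
      have := Real.rpow_le_rpow (by positivity) (H.max_le_end hε₀ j hk') P.κ_pos.le
      gcongr
    have h0 : 0 ≤ ∏ i ∈ Finset.Ico k n, S.γ (s + i) ^ (-α) :=
      Finset.prod_nonneg fun _ _ => Real.rpow_nonneg (S.γ_pos _).le _
    calc _ ≤ (P.E₄ * L ^ P.a) * (P.E₆ * L ^ P.κ * ((n - k : ℕ) : ℝ) ^ (-P.a₀)) :=
          mul_le_mul h1 h2 h0 (by positivity)
      _ = _ := by rw [Real.rpow_add (by linarith)]; ring
  have h3 := H.end_rpow_le hε₀ j (add_nonneg P.κ_pos.le P.a_nonneg)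
  calc _ ≤ ∑ k ∈ Finset.range n, P.E₄ * P.E₆ * L ^ (P.κ + P.a) * ((n - k : ℕ) : ℝ) ^ (-P.a₀) :=
        Finset.sum_le_sum hterm
    _ ≤ P.E₄ * P.E₆ * L ^ (P.κ + P.a) * P.C' := by
        rw [← Finset.mul_sum]
        exact mul_le_mul_of_nonneg_left (P.sum_le_C' n) (by positivity)
    _ ≤ P.E₄ * P.E₆ * (P.E₂ ^ (P.κ + P.a) * P.A₂ ε₀ ^ ((P.κ + P.a) * (1 + P.η₀)) *
        ((j : ℝ) + 1) ^ ((P.κ + P.a) * (P.growth * (1 + P.η₀)))) * P.C' := by gcongr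
    _ = _ := by rw [Constants.E₇]; ring

lemma ξ_inv_end_le (H : S.Standing P R m) (hε₀ : 0 < ε₀) (j : ℕ) :
    (S.ξ (P.ell ε₀ m j + (m (P.N ε₀ (j + 1)) - m (P.N ε₀ j))))⁻¹
      ≤ P.E₈ * P.E₂ ^ P.a₁ * P.A₂ ε₀ ^ (P.a₁ * (1 + P.η₀)) *
        ((j : ℝ) + 1) ^ (P.a₁ * (P.growth * (1 + P.η₀))) := by
  rw [H.ell_add]
  refine (H.ξ_inv_le _ ((P.one_le_N_succ hε₀ j).trans (H.le_m _))).trans ?_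
  rw [mul_assoc, mul_assoc, ← mul_assoc (P.E₂ ^ P.a₁)]
  exact mul_le_mul_of_nonneg_left (H.end_rpow_le hε₀ j P.a₁_nonneg) P.E₈_pos.le

/-- The unperturbed block operators are close to the projections. -/
lemma norm_block_zero_sub_le (H : S.Standing P R m) (hε₀ : 0 < ε₀) (j : ℕ) :
    ‖S.block P ε₀ m j 0 - (S.meas (P.ell ε₀ m j)).smulRight HolderSpace.one‖ ≤ ε₀ / 2 := by
  set s := P.ell ε₀ m j with hs
  set n := m (P.N ε₀ (j + 1)) - m (P.N ε₀ j) with hn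
  set w := (max (P.N ε₀ j : ℝ) 1) ^ (P.ε / P.β) with hw
  have hw0 : 0 < w := by positivity
  have hb := P.one_le_blockScale hε₀
  have hβ := P.β_pos
  have hC := P.one_le_C₁
  have hE0 := P.E₀_pos
  have hD := P.D_pos
  have hbw : P.blockScale ε₀ * w ≤ n := by
    refine (P.le_N_sub hε₀ j).trans ?_
    exact_mod_cast H.sub_le_sub (P.N_le_succ ε₀ j)
  have hbw0 : 0 < P.blockScale ε₀ * w := by positivity
  have hn1 : 1 ≤ n := by
    have : (0 : ℝ) < n := hbw0.trans_le hbw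
    exact_mod_cast this
  have hwβ : w ^ P.β = (max (P.N ε₀ j : ℝ) 1) ^ P.ε := by
    rw [hw, ← Real.rpow_mul (by positivity), div_mul_cancel₀ _ hβ.ne']
  have h1 : (n : ℝ) ^ (-P.β) ≤ ((2 / ε₀ + 1) * P.C₁ * w ^ P.β)⁻¹ := by
    rw [← P.blockScale_rpow hε₀, ← Real.mul_rpow (by linarith) hw0.le,
      ← Real.rpow_neg hbw0.le]
    exact Real.rpow_le_rpow_of_nonpos hbw0 hbw (by linarith)
  have h2 : P.E₀ * R (s + n) * (1 + (s : ℝ) ^ P.εbar) ≤ P.C₁ * w ^ P.β := by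
    -- The block ends at the good time `m (N_{j+1})`, whose index is at least one.
    have hR : R (s + n) ≤ P.D := by
      rw [hs, hn, H.ell_add]
      exact H.R_le (P.one_le_N_succ hε₀ j)
    have hw1 : 1 ≤ w ^ P.β := by
      rw [hwβ]
      exact Real.one_le_rpow (le_max_right _ _) P.ε_pos.le
    have hs1 : (s : ℝ) ^ P.εbar ≤ P.E₂ ^ P.εbar * w ^ P.β := by
      rw [hs, H.ell_eq, hwβ]
      rcases Nat.eq_zero_or_pos (P.N ε₀ j) with h0 | h0
      · rw [h0, H.m_zero, Nat.cast_zero, Real.zero_rpow P.εbar_pos.ne']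
        have := P.E₂_pos
        positivity
      · have hN : (1 : ℝ) ≤ P.N ε₀ j := by exact_mod_cast h0
        rw [max_eq_left hN]
        refine (Real.rpow_le_rpow (by positivity) (H.m_le _ h0) P.εbar_pos.le).trans_eq ?_
        rw [Real.mul_rpow P.E₂_pos.le (by positivity), ← Real.rpow_mul (by positivity),
          Constants.ε, mul_comm P.εbar]
    calc P.E₀ * R (s + n) * (1 + (s : ℝ) ^ P.εbar)
        ≤ P.E₀ * P.D * (w ^ P.β + P.E₂ ^ P.εbar * w ^ P.β) := by gcongr
      _ = (P.E₀ * P.D * (1 + P.E₂ ^ P.εbar)) * w ^ P.β := by ring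
      _ ≤ P.C₁ * w ^ P.β := mul_le_mul_of_nonneg_right (le_max_right _ _) (by positivity)
  refine (H.convergence s n hn1).trans ?_
  have hwp : 0 < w ^ P.β := by positivity
  -- The block length was chosen so that `n ^ β` dominates `u₀ * C₁ * w ^ β`; what is left is `1 /
  -- u₀`, and `u₀ = 2 / ε₀ + 1`.
  calc P.E₀ * R (s + n) * (1 + (s : ℝ) ^ P.εbar) * (n : ℝ) ^ (-P.β)
      ≤ P.C₁ * w ^ P.β * ((2 / ε₀ + 1) * P.C₁ * w ^ P.β)⁻¹ :=
        mul_le_mul h2 h1 (by positivity) (by positivity)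
    _ = (2 / ε₀ + 1)⁻¹ := by
        have : 2 / ε₀ + 1 ≠ 0 := by positivity
        have := hwp.ne'
        field_simp
    _ ≤ (2 / ε₀)⁻¹ := by gcongr; linarith
    _ = ε₀ / 2 := inv_div _ _

end Standing

end ExpandingSequence

/-- Peels off the first operator instead of the last. The two sides live in spaces indexed by `j +
(n + 1)` and `j + 1 + n`, so they are compared through a family `F` over all indices, which avoids
casts. Generalizing `F` lets the induction absorb the last operator into it. -/
lemma seqIter_succ_left {B : ℕ → Type*} [∀ j, NormedAddCommGroup (B j)]
    [∀ j, NormedSpace ℂ (B j)] (A : ∀ j, B j →L[ℂ] B (j + 1)) (j n : ℕ) (g : B j) {Y : Type*}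
    (F : ∀ k, B k → Y) :
    F (j + (n + 1)) (seqIter A j (n + 1) g) = F (j + 1 + n) (seqIter A (j + 1) n (A j g)) := by
  induction n generalizing F with
  | zero => rfl
  | succ n ih => exact ih fun k v => F (k + 1) (A k v)

/-! ### Exponents and the radius of the disc -/

namespace Constants

variable (P : Constants)

lemma ζ₂_eq : (P.κ + P.a) * (P.growth * (1 + P.η₀)) + P.a₁ * (P.growth * (1 + P.η₀)) = P.ζ₂ := by
  unfold growth ζ₂
  ring

lemma growth_mul_nonneg : 0 ≤ P.growth * (1 + P.η₀) :=
  mul_nonneg (zero_le_one.trans P.one_le_growth) (by linarith [P.η₀_nonneg])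

lemma ζ₁_nonneg : 0 ≤ P.ζ₁ :=
  div_nonneg (add_nonneg (mul_nonneg P.β_pos.le (add_nonneg (mul_nonneg P.a_nonneg
    (by linarith [P.η₀_nonneg])) P.δ_nonneg)) P.ε_pos.le) P.sub_pos.le

lemma mul_E_le_of_mem_disc {ε₀ c : ℝ} (hε₀ : 0 < ε₀) (hc : 0 ≤ c) {J : ℕ} {z : ℂ}
    (hz : z ∈ P.disc ε₀ c J) :
    ‖z‖ * P.E₅ ε₀ * ((J : ℝ) + 1) ^ (P.ζ₁ + P.ζ₂) ≤ c ∧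
      ‖z‖ * P.E₉ ε₀ * ((J : ℝ) + 1) ^ (P.ζ₁ + P.ζ₂) ≤ c := by
  have hJ : (0 : ℝ) < (J : ℝ) + 1 := by positivity
  rw [disc, mem_closedBall_zero_iff, show -P.ζ₁ - P.ζ₂ = -(P.ζ₁ + P.ζ₂) by ring,
    Real.rpow_neg hJ.le] at hz
  have hQ : 0 < ((J : ℝ) + 1) ^ (P.ζ₁ + P.ζ₂) := Real.rpow_pos_of_pos hJ _
  have key : ∀ E : ℝ, 0 < E → min (P.E₅ ε₀)⁻¹ (P.E₉ ε₀)⁻¹ ≤ E⁻¹ →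
      ‖z‖ * E * ((J : ℝ) + 1) ^ (P.ζ₁ + P.ζ₂) ≤ c := by
    intro E hE hmin
    calc _ ≤ c * E⁻¹ * (((J : ℝ) + 1) ^ (P.ζ₁ + P.ζ₂))⁻¹ * E *
          ((J : ℝ) + 1) ^ (P.ζ₁ + P.ζ₂) := by
          gcongr
          exact hz.trans (by gcongr)
      _ = c := by field_simp
  exact ⟨key _ (P.E₅_pos hε₀) (min_le_left _ _), key _ (P.E₉_pos hε₀) (min_le_right _ _)⟩

end Constants

/-! ### Equivariance of the measures and closeness of the perturbed blocks -/

namespace ExpandingSequence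

variable {X : ℕ → Type*} [∀ j, MetricSpace (X j)] [∀ j, MeasurableSpace (X j)]
  [∀ j, BorelSpace (X j)] {α : ℝ} {S : ExpandingSequence X α}

namespace Standing

variable {P : Constants} {R : ℕ → ℝ} {m : ℕ → ℕ} {ε₀ : ℝ}

/-- The measures are equivariant under the duals of the unperturbed transfer operators. -/
lemma meas_transfer (H : S.Standing P R m) (j : ℕ) (g : HolderSpace α (X j)) :
    S.meas (j + 1) (S.transfer j 0 g) = S.meas j g := by
  set L := fun i => S.transfer i 0 with hL
  have hE0 := P.E₀_pos
  have hD := P.D_pos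
  have hβ := P.β_pos
  have hconv : ∀ (i n k : ℕ) (hn : 1 ≤ n) (hk : i + n = m k) (_ : 1 ≤ k) (u : HolderSpace α (X i)),
      ‖seqIter L i n u - S.meas i u • HolderSpace.one‖
        ≤ P.E₀ * P.D * (1 + (i : ℝ) ^ P.εbar) * ‖u‖ * (n : ℝ) ^ (-P.β) := by
    intro i n k hn hk hk1 u
    refine (ContinuousLinearMap.le_of_opNorm_le (seqIter L i n
      - (S.meas i).smulRight HolderSpace.one) (H.convergence i n hn) u).trans ?_
    have hR : R (i + n) ≤ P.D := by rw [hk]; exact H.R_le hk1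
    rw [mul_right_comm _ ‖u‖]
    gcongr
  set K : ℝ := P.E₀ * P.D * (1 + (j : ℝ) ^ P.εbar) * ‖g‖
    + P.E₀ * P.D * (1 + ((j + 1 : ℕ) : ℝ) ^ P.εbar) * ‖S.transfer j 0 g‖ with hK
  have hK0 : 0 ≤ K := by positivity
  -- Up to a good time the iterate of `g` from `j` is the iterate of `L_j g` from `j + 1`. It is
  -- close to both `μ_j(g) 1` and `μ_{j+1}(L_j g) 1`, so the two numbers differ by at most a
  -- multiple of `i ^ (-β)`, for every `i`.
  have hbound : ∀ i : ℕ, 1 ≤ i →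
      ‖S.meas (j + 1) (S.transfer j 0 g) - S.meas j g‖ ≤ K * (i : ℝ) ^ (-P.β) := by
    intro i hi
    -- As `k ≤ m k`, the good time with index `i + j + 1` leaves at least `i` iterations after `j +
    -- 1`.
    obtain ⟨n, hn⟩ : ∃ n, m (i + j + 1) = j + 1 + n :=
      ⟨m (i + j + 1) - (j + 1), by have := H.le_m (i + j + 1); omega⟩
    have hin : i ≤ n := by have := H.le_m (i + j + 1); omega
    have hi0 : (0 : ℝ) < i := by exact_mod_cast hi
    have hin' : (i : ℝ) ≤ n := by exact_mod_cast hin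
    have b1 := hconv j (n + 1) (i + j + 1) (by omega) (by omega) (by omega) g
    have b2 := hconv (j + 1) n (i + j + 1) (by omega) (by omega) (by omega) (S.transfer j 0 g)
    rw [seqIter_succ_left L j n g fun k v => ‖v - S.meas j g • (HolderSpace.one :
      HolderSpace α (X k))‖] at b1
    have p1 : ((n + 1 : ℕ) : ℝ) ^ (-P.β) ≤ (i : ℝ) ^ (-P.β) :=
      Real.rpow_le_rpow_of_nonpos hi0 (by push_cast; linarith) (by linarith)
    have p2 : (n : ℝ) ^ (-P.β) ≤ (i : ℝ) ^ (-P.β) :=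
      Real.rpow_le_rpow_of_nonpos hi0 hin' (by linarith)
    set u := seqIter L (j + 1) n (S.transfer j 0 g) with hu
    set c := S.meas (j + 1) (S.transfer j 0 g) with hc
    set c' := S.meas j g with hc'
    have e1 : c - c' = S.meas (j + 1 + n) ((u - c' • HolderSpace.one) - (u - c • HolderSpace.one))
        := by
      rw [sub_sub_sub_cancel_left, ← sub_smul, map_smul, S.meas_one, smul_eq_mul, mul_one]
    rw [e1]
    refine (ContinuousLinearMap.le_of_opNorm_le _ (S.norm_meas_le _) _).trans ?_
    rw [one_mul]
    refine (norm_sub_le _ _).trans ((add_le_add b1 b2).trans ?_)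
    rw [hK, add_mul]
    gcongr
  have hlim : Filter.Tendsto (fun i : ℕ => K * (i : ℝ) ^ (-P.β)) Filter.atTop (nhds 0) := by
    have h := ((tendsto_rpow_neg_atTop hβ).comp tendsto_natCast_atTop_atTop).const_mul K
    rwa [mul_zero] at h
  have h0 := ge_of_tendsto hlim (Filter.eventually_atTop.2 ⟨1, hbound⟩)
  exact sub_eq_zero.1 (norm_le_zero_iff.1 h0)

lemma meas_seqIter (H : S.Standing P R m) (j n : ℕ) (g : HolderSpace α (X j)) :
    S.meas (j + n) (seqIter (fun i => S.transfer i 0) j n g) = S.meas j g := by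
  induction n with
  | zero => rfl
  | succ n ih =>
    refine Eq.trans ?_ ih
    exact H.meas_transfer (j + n) _

/-- The perturbed block operators are close to the unperturbed ones. -/
lemma norm_block_sub_le (H : S.Standing P R m) (hε₀ : 0 < ε₀) (hε₁ : ε₀ < 1) {J j : ℕ}
    (hj : j ≤ J) {z : ℂ} (hz : z ∈ P.disc ε₀ (ε₀ / 60) J) :
    ‖S.block P ε₀ m j z - S.block P ε₀ m j 0‖ ≤ ε₀ / 20 := by
  obtain ⟨hz5, hz9⟩ := P.mul_E_le_of_mem_disc hε₀ (by positivity) hz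
  have hE5 := P.E₅_pos hε₀
  have hE7 := P.E₇_pos hε₀
  have hC := P.C'_nonneg
  have hq : (0 : ℝ) < (j : ℝ) + 1 := by positivity
  have hq1 : (1 : ℝ) ≤ (j : ℝ) + 1 := by linarith [j.cast_nonneg (α := ℝ)]
  have hη := P.growth_mul_nonneg
  set x := (P.κ + P.a) * (P.growth * (1 + P.η₀)) with hx
  set y := P.a₁ * (P.growth * (1 + P.η₀)) with hy
  have hx0 : 0 ≤ x := mul_nonneg (add_nonneg P.κ_pos.le P.a_nonneg) hη
  have hy0 : 0 ≤ y := mul_nonneg P.a₁_nonneg hη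
  have hxy : x + y = P.ζ₂ := P.ζ₂_eq
  set Q := ((J : ℝ) + 1) ^ (P.ζ₁ + P.ζ₂) with hQ
  -- All powers of the block index are dominated by the single power of `J + 1` in the radius; this
  -- uses `j ≤ J`.
  have hpow : ∀ r, r ≤ P.ζ₁ + P.ζ₂ → ((j : ℝ) + 1) ^ r ≤ Q := by
    intro r hr
    refine (Real.rpow_le_rpow_of_exponent_le hq1 hr).trans (Real.rpow_le_rpow hq.le ?_ ?_)
    · have : (j : ℝ) ≤ J := by exact_mod_cast hj
      linarith
    · linarith [P.ζ₁_nonneg]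
  set a := ((j : ℝ) + 1) ^ P.ζ₁ with ha
  set b := ((j : ℝ) + 1) ^ x with hb
  set d := ((j : ℝ) + 1) ^ y with hd
  have hζ := P.ζ₁_nonneg
  have haQ : a ≤ Q := hpow _ (by linarith)
  have hbQ : b ≤ Q := hpow _ (by linarith)
  have habQ : a * b ≤ Q := by rw [ha, hb, ← Real.rpow_add hq]; exact hpow _ (by linarith)
  have hadQ : a * d ≤ Q := by rw [ha, hd, ← Real.rpow_add hq]; exact hpow _ (by linarith)
  set K := P.E₈ * P.E₂ ^ P.a₁ * P.A₂ ε₀ ^ (P.a₁ * (1 + P.η₀)) with hK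
  -- The near-point bound `h2` lacks the factor `K` of `E₉`, so it must be at least one.
  have hK1 : 1 ≤ K :=
    one_le_mul_of_one_le_of_one_le (one_le_mul_of_one_le_of_one_le H.one_le_E₈
      (Real.one_le_rpow H.one_le_E₂ P.a₁_nonneg))
      (Real.one_le_rpow (P.one_le_A₂ hε₀)
        (mul_nonneg P.a₁_nonneg (by linarith [P.η₀_nonneg])))
  have hE9 : P.E₉ ε₀ = 6 * K * (P.E₅ ε₀ + P.C' * P.E₅ ε₀ * P.E₇ ε₀ + P.C' * P.E₇ ε₀) := by
    rw [Constants.E₉, hK]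
    ring
  have hQ0 : 0 < Q := by positivity
  set t := ‖z‖ with ht
  have ht0 : 0 ≤ t := norm_nonneg z
  have htF : t * (P.E₅ ε₀ * a) ≤ ε₀ / 60 := by
    refine le_trans ?_ hz5
    rw [← mul_assoc]
    gcongr
  have h1 : 4 * (t * (P.E₅ ε₀ * a)) * (K * d) ≤ ε₀ / 60 := by
    refine le_trans ?_ hz9
    calc 4 * (t * (P.E₅ ε₀ * a)) * (K * d) = t * (4 * K * P.E₅ ε₀) * (a * d) := by ring
      _ ≤ t * (4 * K * P.E₅ ε₀) * Q := by gcongr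
      _ ≤ t * P.E₉ ε₀ * Q := by
          rw [hE9]
          have h2 : 0 ≤ P.C' * P.E₅ ε₀ * P.E₇ ε₀ + P.C' * P.E₇ ε₀ := by positivity
          gcongr
          · norm_num
          · linarith
  have h2 : t * (4 * (P.E₅ ε₀ * a * (P.C' * P.E₇ ε₀ * b)) + 3 * (P.C' * P.E₇ ε₀ * b)
      + 2 * (P.E₅ ε₀ * a)) ≤ ε₀ / 60 := by
    refine le_trans ?_ hz9
    calc _ = t * (4 * (P.C' * P.E₅ ε₀ * P.E₇ ε₀) * (a * b) + 3 * (P.C' * P.E₇ ε₀) * b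
          + 2 * P.E₅ ε₀ * a) := by ring
      _ ≤ t * (6 * (P.C' * P.E₅ ε₀ * P.E₇ ε₀) * Q + 6 * (P.C' * P.E₇ ε₀) * Q
          + 6 * P.E₅ ε₀ * Q) := by gcongr <;> norm_num
      _ = t * (6 * 1 * (P.E₅ ε₀ + P.C' * P.E₅ ε₀ * P.E₇ ε₀ + P.C' * P.E₇ ε₀)) * Q := by ring
      _ ≤ t * P.E₉ ε₀ * Q := by rw [hE9]; gcongr
  have h := S.norm_seqIter_transfer_sub_le (P.ell ε₀ m j)
    (m (P.N ε₀ (j + 1)) - m (P.N ε₀ j)) z (H.birkhoffSup_le hε₀ j)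
    (H.birkhoffVar_le hε₀ j H.φ_le) (H.birkhoffVar_le hε₀ j H.f_le) (H.ξ_inv_end_le hε₀ j)
    (htF.trans (by linarith))
  refine h.trans ?_
  -- With `c = ε₀ / 60` the sup part contributes `2 * c` and the Hölder part `c`, which add up to
  -- `ε₀ / 20`.
  have h3 := max_le h1 h2
  linarith

/-- The block operators satisfy the hypotheses of the abstract perturbation theorem. -/
lemma nearRankOne (H : S.Standing P R m) (hε₀ : 0 < ε₀) (hε₀' : ε₀ < 0.17) {J : ℕ} {z : ℂ}
    (hz : z ∈ P.disc ε₀ (ε₀ / 60) J) :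
    NearRankOne ε₀ (fun j => (HolderSpace.one : HolderSpace α (X (P.ell ε₀ m j))))
      (fun j => S.meas (P.ell ε₀ m j)) (S.blockJ P ε₀ m J 0) (S.blockJ P ε₀ m J z) J := by
  have h0 : ∀ j, S.blockJ P ε₀ m J 0 j = S.block P ε₀ m j 0 := fun j => by
    rw [blockJ, ite_self]
  refine ⟨hε₀, hε₀', fun j => HolderSpace.norm_one_le, fun j => S.norm_meas_le _,
    fun j => S.meas_one _, fun j => ?_, fun j => ?_, fun j => ?_, fun j => ?_, fun j hj => ?_⟩
  · rw [h0]
    exact S.seqIter_transfer_one _ _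
  · ext g
    rw [h0]
    exact H.meas_seqIter _ _ g
  · rw [h0]
    exact H.norm_block_zero_sub_le hε₀ j
  · rw [h0, blockJ]
    split_ifs with hj
    · exact H.norm_block_sub_le hε₀ (by linarith) hj hz
    · rw [sub_self, norm_zero]
      positivity
  · rw [h0, blockJ, if_neg (not_le.2 hj)]

end Standing

lemma analyticAt_blockJ (P : Constants) (ε₀ : ℝ) (m : ℕ → ℕ) (J j : ℕ) (z : ℂ) :
    AnalyticAt ℂ (fun w => S.blockJ P ε₀ m J w j) z := by
  unfold blockJ
  split_ifs
  · exact analyticAt_seqIter (A := fun w i => S.transfer i w)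
      (fun i => S.analyticAt_transfer i z) _ _
  · exact analyticAt_const

end ExpandingSequence

end

theorem mainTheorem10 (ε₀ : ℝ) (hε₀ : 0 < ε₀) (hε₀' : ε₀ < 0.17) :
    ∃ c > (0 : ℝ), ∃ R₀ > (0 : ℝ), ∃ M > (0 : ℝ),
      ∀ (X : ℕ → Type*) [∀ j, MetricSpace (X j)] [∀ j, MeasurableSpace (X j)]
        [∀ j, BorelSpace (X j)] (α : ℝ) (S : ExpandingSequence X α)
        (P : Constants) (R : ℕ → ℝ) (m : ℕ → ℕ), S.Standing P R m → ∀ J : ℕ,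
      ∃ (lam : ℕ → ℂ → ℂ)
        (h : ∀ j, ℂ → HolderSpace α (X (P.ell ε₀ m j)))
        (ν : ∀ j, ℂ → (HolderSpace α (X (P.ell ε₀ m j)) →L[ℂ] ℂ)),
        -- analyticity
        (∀ j, AnalyticOnNhd ℂ (lam j) (P.disc ε₀ c J) ∧
          AnalyticOnNhd ℂ (h j) (P.disc ε₀ c J) ∧
          AnalyticOnNhd ℂ (ν j) (P.disc ε₀ c J)) ∧
        -- uniform boundedness
        (∀ j, ∀ z ∈ P.disc ε₀ c J,
          lam j z ≠ 0 ∧ ‖lam j z‖ ≤ M ∧ ‖h j z‖ ≤ M ∧ ‖ν j z‖ ≤ M) ∧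
        -- values at zero and normalization
        (∀ j, lam j 0 = 1 ∧ h j 0 = HolderSpace.one ∧ ν j 0 = S.meas (P.ell ε₀ m j)) ∧
        (∀ j, ∀ z ∈ P.disc ε₀ c J, ν j z HolderSpace.one = 1 ∧ ν j z (h j z) = 1) ∧
        -- equivariance
        (∀ j, ∀ z ∈ P.disc ε₀ c J,
          S.blockJ P ε₀ m J z j (h j z) = lam j z • h (j + 1) z ∧
          (ν (j + 1) z).comp (S.blockJ P ε₀ m J z j) = lam j z • ν j z) ∧
        -- exponential convergence
        (∀ j n, ∀ z ∈ P.disc ε₀ c J,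
          ‖(∏ k ∈ Finset.range n, lam (j + k) z)⁻¹ • seqIter (S.blockJ P ε₀ m J z) j n
              - (ν j z).smulRight (h (j + n) z)‖ ≤ R₀ * (2 * ε₀) ^ n) := by

  -- The disc constant comes from `norm_block_sub_le`; `4` and `2` are the constants of
  -- `exists_triplets`, applied with `θ = ε₀`.
  refine ⟨ε₀ / 60, by positivity, 4, by norm_num, 2, by norm_num, ?_⟩
  intro X _ _ _ α S P R m H J
  have h0 : (0 : ℂ) ∈ P.disc ε₀ (ε₀ / 60) J := by
    have := P.E₅_pos hε₀
    have := P.E₉_pos hε₀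
    rw [Constants.disc]
    exact Metric.mem_closedBall_self (by positivity)
  exact exists_triplets (A := S.blockJ P ε₀ m J) h0
    (fun j z _ => S.analyticAt_blockJ P ε₀ m J j z) fun z hz => H.nearRankOne hε₀ hε₀' hz
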